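/- **Model.** Let $n\ge k\ge 1$, $t\ge 0$ be integers and $\lambda,\mu>0$. There are $n$ identical servers and a buffer of infinite capacity, initially without jobs. Batches of $k$ jobs arrive as a Poisson process of rate $\lambda$; all service times are exponential of rate $\mu$ and independent of all else, so the server-by-server configuration process (for every batch that still has a job in the buffer, which servers have completed and which are now processing one of its jobs; and which servers are processing jobs of other batches) is the continuous-time Markov chain in which a batch arrives at rate $\lambda$ and each busy server completes its job at rate $\mu$. A batch is *waiting* if at least one of its jobs is in the buffer (has not begun service); waiting batches are ordered by arrival, and each server may be given at most one job of a batch. The MDS-Reservation($t$) policy is as follows. For $t\ge1$: *(arrival of a batch)* if fewer than $t$ batches are waiting, assign one job each of the new batch to idle servers, as many as possible; the remaining jobs, if any, are appended at the end of the buffer as a waiting batch. *(Completion of a job by server $s$)* let $\hat\imath$ be the least $i\ge1$ such that $s$ has not served a job of the $i$-th waiting batch; if $\hat\imath$ exists and $\hat\imath\le t$, assign a job of the $\hat\imath$-th waiting batch to $s$; if moreover $\hat\imath=1$, the first waiting batch had only one job in the buffer, and there was a $(t+1)$-st waiting batch, assign a job of that $(t+1)$-st batch to every remaining idle server. For $t=0$: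 *(arrival)* if at least $k$ servers are idle, assign the $k$ jobs of the batch to $k$ idle servers, otherwise append the batch to the buffer. *(Completion)* if at least $k$ servers are idle and the buffer is non-empty, assign the $k$ jobs of the first waiting batch to $k$ idle servers. Where there is a choice between idle servers, it is made by an arbitrary, possibly randomised, rule that may depend on the current configuration. **Theorem.** In a given configuration, let $m$ be the number of jobs in the system (in the buffer or being processed), $z$ the number of idle servers, $b$ the number of waiting batches, and for $1\le i\le b$ let $w_i$ and $s_i$ be the numbers of jobs of the $i$-th waiting batch in the buffer and being processed, respectively; put $w_i=0$ for $i>b$. Under MDS-Reservation($t$): 1. (Markovian representation) The process $(w_1,\dots,w_t,m)$, started at $(0,\dots,0,0)$, is a non-explosive continuous-time Markov chain on the state space $\{0,\dots,k\}^t\times\{0,1,2,\dots\}$ (some of whose states may never be visited), with a generator $Q$ that depends only on $n,k,t,\lambda,\mu$. 2. (Recovery of the configuration) There is a function of $(w_1,\dots,w_t,m)$, depending only on $n,k,t$, that almost surely at all times gives the complete description $m$, $z$, $b$, $(s_i)_{i=1}^b$, $(w_i)_{i=1}^b$ of the system. 3. (QBD structure) $Q$ can be chosen (on the states that are never visited)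 so that the chain is a quasi-birth-death process with boundary states $\{0,\dots,k\}^t\times\{0,\dots,n-k+tk\}$ and levels $\{0,\dots,k\}^t\times\{n-k+1+jk,\dots,n+jk\}$, $j=t,t+1,\dots$. That is, these sets partition the state space and, when the states of different levels are identified through $(w_1,\dots,w_t,m)\mapsto(w_1,\dots,w_t,m+k)$, $Q$ has the block form $$\begin{bmatrix} B_1&B_2&0&0&\cdots\\ B_0&A_1&A_2&0&\cdots\\ 0&A_0&A_1&A_2&\cdots\\ 0&0&A_0&A_1&\cdots\\ \vdots&\vdots&\vdots&\vdots&\ddots\end{bmatrix}$$ with finite matrices $B_0,B_1,B_2,A_0,A_1,A_2$. -/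

import Mathlib

open MeasureTheory
open scoped NNReal ENNReal

noncomputable section

namespace MDSQueue

/-! ### Continuous-time Markov chains and quasi-birth-death processes -/

/-- A conservative generator (Q-matrix) on a set `S` of states: the off-diagonal entries are
transition rates and every row sums to zero, so that `-Q x x` is the total rate out of `x`. -/
def IsGenerator {S : Type*} (Q : Matrix S S ℝ) : Prop :=
  (∀ x y, x ≠ y → 0 ≤ Q x y) ∧ ∀ x, HasSum (fun y => Q x y) 0

open Classical in
/-- Transition probabilities of the jump chain of the generator `Q`. A state without outgoing
transitions is absorbing. -/
def jumpProb {S : Type*} (Q : Matrix S S ℝ) (x y : S) : ℝ :=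
  if Q x x = 0 then (if y = x then 1 else 0)
  else if y = x then 0 else Q x y / (-Q x x)

/-- `X` is a (non-explosive, right-continuous) continuous-time Markov chain on the discrete state
space `S` with generator `Q`, started in `x₀`: the successive states `J 0, J 1, …` form a Markov
chain with the transition probabilities `jumpProb Q`, and given these states the holding times
`T 0, T 1, …` are independent, `T i` being exponential of rate `-Q (J i) (J i)`
(`T i = ∞` if that rate is zero). -/
def IsCTMC {S Ω : Type*} [MeasurableSpace Ω] (P : Measure Ω) (Q : Matrix S S ℝ) (x₀ : S)
    (X : ℝ≥0 → Ω → S) : Prop :=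
  ∃ (J : ℕ → Ω → S) (T : ℕ → Ω → ℝ≥0∞),
    (∀ i (A : Set S), MeasurableSet (J i ⁻¹' A)) ∧
    (∀ i, Measurable (T i)) ∧
    (∀ᵐ ω ∂P, J 0 ω = x₀) ∧
    (∀ (N : ℕ) (x : ℕ → S) (u : ℕ → ℝ≥0), x 0 = x₀ →
      P {ω | (∀ i ≤ N, J i ω = x i) ∧ ∀ i < N, (u i : ℝ≥0∞) < T i ω} =
        ENNReal.ofReal (∏ i ∈ Finset.range N,
          (Real.exp (Q (x i) (x i) * u i) * jumpProb Q (x i) (x (i + 1))))) ∧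
    (∀ᵐ ω ∂P, ∑' i, T i ω = ∞) ∧
    ∀ᵐ ω ∂P, ∀ (N : ℕ) (r : ℝ≥0), ∑ i ∈ Finset.range N, T i ω ≤ r →
      (r : ℝ≥0∞) < ∑ i ∈ Finset.range (N + 1), T i ω → X r ω = J N ω

/-- The block tridiagonal matrix
```
B₁ B₂ 0  0  ⋯
B₀ A₁ A₂ 0  ⋯
0  A₀ A₁ A₂ ⋯
0  0  A₀ A₁ ⋯
```
with boundary block indexed by `B` and levels `0, 1, 2, …` each indexed by `L`. -/
def qbdMatrix {B L : Type*} (B₀ : Matrix L B ℝ) (B₁ : Matrix B B ℝ) (B₂ : Matrix B L ℝ)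
    (A₀ A₁ A₂ : Matrix L L ℝ) : Matrix (B ⊕ ℕ × L) (B ⊕ ℕ × L) ℝ
  | .inl b, .inl b' => B₁ b b'
  | .inl b, .inr (i, l) => if i = 0 then B₂ b l else 0
  | .inr (i, l), .inl b => if i = 0 then B₀ l b else 0
  | .inr (i, l), .inr (j, l') =>
      if j = i + 1 then A₂ l l' else if j = i then A₁ l l' else if i = j + 1 then A₀ l l' else 0

/-- `Q` is the generator of a QBD process on `S`, where `e` enumerates `S` without repetition:
`e (.inl b)`, `b : B`, are the (finitely many) boundary states and `e (.inr (i, l))`, `l : L`, are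
the (finitely many) states of the `i`-th level. -/
def IsQBD {S B L : Type*} [Finite B] [Finite L] (e : B ⊕ ℕ × L → S) (Q : Matrix S S ℝ) : Prop :=
  Function.Bijective e ∧ IsGenerator Q ∧
  ∃ (B₀ : Matrix L B ℝ) (B₁ : Matrix B B ℝ) (B₂ : Matrix B L ℝ) (A₀ A₁ A₂ : Matrix L L ℝ),
    Q.submatrix e e = qbdMatrix B₀ B₁ B₂ A₀ A₁ A₂

/-! ### The queue, server by server -/

/-- A batch of `k` jobs that is waiting in the buffer: the servers that have completed a job of
this batch, and the servers that are now processing one. -/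
structure Batch (n : ℕ) where
  done : Finset (Fin n)
  active : Finset (Fin n)

/-- The servers that have been assigned a job of this batch, whether completed or not. -/
def Batch.served {n : ℕ} (b : Batch n) : Finset (Fin n) := b.done ∪ b.active

/-- Number of jobs of the batch that are still in the buffer. -/
def Batch.inBuffer {n : ℕ} (k : ℕ) (b : Batch n) : ℕ := k - (b.done.card + b.active.card)

/-- A configuration of a system of `n` servers: the waiting batches, i.e. those with at least one
job in the buffer, in order of arrival; and the servers processing a job of a batch all of whose
jobs have already left the buffer. -/
structure Config (n : ℕ) where
  waiting : List (Batch n)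
  other : Finset (Fin n)

namespace Config

variable {n : ℕ}

/-- No jobs in the system. -/
def empty (n : ℕ) : Config n := ⟨[], ∅⟩

def busy (c : Config n) : Finset (Fin n) :=
  c.waiting.foldr (fun b A => b.active ∪ A) c.other

def idle (c : Config n) : Finset (Fin n) := (c.busy)ᶜ

/-- Number of jobs in the entire system: those in the buffer and those being processed. -/
def jobs (k : ℕ) (c : Config n) : ℕ := (c.waiting.map (Batch.inBuffer k)).sum + c.busy.card

/-- Append a new batch at the end of the buffer, the servers in `A` starting one job each. -/
def append (A : Finset (Fin n)) (c : Config n) : Config n :=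
  { c with waiting := c.waiting ++ [⟨∅, A⟩] }

/-- Each of the servers in `A` starts a job of the waiting batch at position `i`
(counted from `0`). -/
def assign (i : ℕ) (A : Finset (Fin n)) (c : Config n) : Config n :=
  { c with waiting := c.waiting.modify i (fun b => ⟨b.done, b.active ∪ A⟩) }

/-- Server `s` completes the job it is processing. -/
def release (s : Fin n) (c : Config n) : Config n where
  waiting := c.waiting.map
    (fun b => if s ∈ b.active then ⟨insert s b.done, b.active.erase s⟩ else b)
  other := c.other.erase s

/-- Batches without jobs in the buffer are no longer waiting. -/
def settle (k : ℕ) (c : Config n) : Config n where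
  waiting := c.waiting.filter (fun b => b.inBuffer k ≠ 0)
  other := (c.waiting.filter (fun b => b.inBuffer k = 0)).foldr (fun b A => b.active ∪ A) c.other

end Config

/-- A rule, possibly randomised, that decides which idle servers receive the jobs of a batch:
one job each, to `k` of the idle servers, or to all of them if there are fewer than `k`. -/
structure Selection (n k : ℕ) where
  law : Config n → PMF (Finset (Fin n))
  spec : ∀ c, ∀ A ∈ (law c).support, A ⊆ c.idle ∧ A.card = min k c.idle.card

/-- The configuration after the arrival of a batch, under MDS-Reservation(`t`). If `t ≥ 1`, the new
batch may start service if fewer than `t` batches are waiting. If `t = 0`, it may start service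
if at least `k` servers are idle (and then all its jobs do). -/
def arrival {n k : ℕ} (t : ℕ) (sel : Selection n k) (c : Config n) : PMF (Config n) :=
  if c.waiting.length < t ∨ (t = 0 ∧ k ≤ c.idle.card) then
    (sel.law c).map (fun A => (c.append A).settle k)
  else PMF.pure (c.append ∅)

/-- The configuration after server `s` completes its job, under MDS-Reservation(`0`): the first
waiting batch, if any, starts service if at least `k` servers are idle. -/
def departureZero {n k : ℕ} (sel : Selection n k) (s : Fin n) (c : Config n) : PMF (Config n) :=
  let c₁ := c.release s
  if k ≤ c₁.idle.card ∧ c₁.waiting ≠ [] then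
    (sel.law c₁).map (fun A => (c₁.assign 0 A).settle k)
  else PMF.pure c₁

/-- The configuration after server `s` completes its job, under MDS-Reservation(`t`), `t ≥ 1`.
Positions in the buffer are counted from `0`. Server `s` takes a job of the first waiting batch that
it has not served, if this is one of the first `t`. If this was the last job in the buffer of
the first waiting batch, the former `(t+1)`-st waiting batch (if any) enters the first `t`, and every
remaining idle server takes a job of it. -/
def departureSucc {n k : ℕ} (t : ℕ) (sel : Selection n k) (s : Fin n) (c : Config n) :
    PMF (Config n) :=
  let c₁ := c.release s
  match c₁.waiting.findIdx? (fun b => s ∉ b.served) with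
  | none => PMF.pure c₁
  | some i =>
    if i < t then
      let c₂ := c₁.assign i {s}
      if i = 0 ∧ (c₁.waiting.head?.map (Batch.inBuffer k) = some 1) ∧ t < c₁.waiting.length then
        (sel.law c₂).map (fun A => (c₂.assign t A).settle k)
      else PMF.pure (c₂.settle k)
    else PMF.pure c₁

/-- The configuration after server `s` completes its job, under MDS-Reservation(`t`). -/
def departure {n k : ℕ} (t : ℕ) (sel : Selection n k) (s : Fin n) (c : Config n) :
    PMF (Config n) :=
  if t = 0 then departureZero sel s c else departureSucc t sel s c

/-- Generator of the configuration process of the MDS-Reservation(`t`) queue: batches arrive at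
rate `lam`, and every busy server completes its job at rate `mu`, independently of all else. -/
def queueGenerator {n k : ℕ} (t : ℕ) (lam mu : ℝ) (sel : Selection n k) :
    Matrix (Config n) (Config n) ℝ := fun c c' =>
  lam * ((arrival t sel c c').toReal - (PMF.pure c c').toReal) +
    ∑ s ∈ c.busy, mu * ((departure t sel s c c').toReal - (PMF.pure c c').toReal)

/-- `X` is the configuration process of an MDS-Reservation(`t`) queue with parameters `(n, k)`,
arrival rate `lam` and service rate `mu`, started without jobs. -/
def IsReservationQueue {n k : ℕ} {Ω : Type*} [MeasurableSpace Ω] (P : Measure Ω) (t : ℕ)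
    (lam mu : ℝ) (sel : Selection n k) (X : ℝ≥0 → Ω → Config n) : Prop :=
  IsCTMC P (queueGenerator t lam mu sel) (Config.empty n) X

/-! ### The reduced state, and the description of the system -/

/-- The states `(w₁, …, w_t, m)` in `{0, …, k}^t × ℕ`. -/
abbrev State (k t : ℕ) : Type := (Fin t → Fin (k + 1)) × ℕ

/-- `w_i` is the number of jobs of the `i`-th waiting batch that are in the buffer (`0` if there is
no such batch) and `m` is the number of jobs in the system. -/
def reducedState {n : ℕ} (k t : ℕ) (c : Config n) : State k t :=
  (fun i => match c.waiting[(i : ℕ)]? with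
    | some b => ⟨b.inBuffer k, Nat.lt_succ_of_le (Nat.sub_le _ _)⟩
    | none => 0,
   c.jobs k)

/-- The parameters that describe the system: the number of jobs in the system, the number of idle
servers, and, for every waiting batch in order of arrival, the number of its jobs that are being
processed and the number of its jobs in the buffer. (The length of the list is the number of
waiting batches.) -/
structure Description where
  jobs : ℕ
  idle : ℕ
  batches : List (ℕ × ℕ)

def describe {n : ℕ} (k : ℕ) (c : Config n) : Description :=
  ⟨c.jobs k, c.idle.card, c.waiting.map (fun b => (b.active.card, b.inBuffer k))⟩

/-- Boundary `{0, …, k}^t × {0, …, n-k+tk}` and levels `{0, …, k}^t × {n-k+1+jk, …, n+jk}`, `j ≥ t`;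
the `i`-th level has `j = t + i`, and its states are matched with those of the other levels by
the offset `r = m - (n-k+1+jk)`, `0 ≤ r < k`. -/
def stateOf (n k t : ℕ) :
    ((Fin t → Fin (k + 1)) × Fin (n - k + t * k + 1)) ⊕ ℕ × ((Fin t → Fin (k + 1)) × Fin k) →
      State k t
  | .inl (w, m) => (w, m)
  | .inr (i, (w, r)) => (w, n - k + 1 + (t + i) * k + r)

end MDSQueue

end

namespace MDSQueue

/-! ### Lumping of continuous-time Markov chains -/

/-! A server always takes a job of the first waiting batch it has not served, so the batches it has
served form a prefix of the buffer. A reachable configuration is therefore determined by the number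
`b` of waiting batches, the class `p s` of each server (the length of its prefix) and the set `β` of
busy servers (`classConfig`). The policy preserves `Admissible`: `p s ≤ min b t`, with equality for
idle servers, and each waiting batch has been started by fewer than `k` servers.

Batch `j` has been started by the servers with `p s > j`, so `w_1, …, w_t` give the class sizes.
Counting jobs gives `n + ∑ w_i - m = z - k (b - t)⁺`. If `b > t` then `z < k`, since the idle
servers have all served the last reserved batch (for `t = 0` the bound is part of the invariant).
The sign of this number and division by `k` thus recover `z` and `b`, and then the whole description
(`Admissible.describe_eq`).

An arrival, and a completion by a server of class `p`, each lead to one definite reduced state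
(`Admissible.arrival_support`, `Admissible.departure_support`). The choice among idle servers is
real only when the buffer is empty, where it is invisible in the reduced state. Total rates into
fibres thus depend only on the reduced state. Every jump changes `m`, so no jump is lost under
projection and the holding times survive: `IsCTMC.lump` applies.

For large `m` the rates and the changes of state depend on `m` only modulo `k`, and a jump changes
`m` by `k` or `-1`. This is the QBD structure (`reducedGenerator_shift`,
`reducedGenerator_eq_zero`). -/

theorem IsGenerator.diag_nonpos {S : Type*} {Q : Matrix S S ℝ} (hQ : IsGenerator Q) (x : S) :
    Q x x ≤ 0 := by
  classical
  have h := (hQ.2 x).sub (hasSum_ite_eq x (Q x x))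
  have h0 : 0 ≤ 0 - Q x x := by
    refine h.nonneg fun y => ?_
    by_cases hy : y = x
    · simp [hy]
    · simpa [hy] using hQ.1 x y (Ne.symm hy)
  linarith

theorem IsGenerator.jumpProb_nonneg {S : Type*} {Q : Matrix S S ℝ} (hQ : IsGenerator Q) (x y : S) :
    0 ≤ jumpProb Q x y := by
  unfold jumpProb
  have := hQ.diag_nonpos x
  split_ifs with h1 h2 h2
  · exact zero_le_one
  · exact le_rfl
  · exact le_rfl
  · exact div_nonneg (hQ.1 x y (Ne.symm h2)) (by linarith)

theorem measurableSet_path {S Ω : Type*} [MeasurableSpace Ω] {J : ℕ → Ω → S} {T : ℕ → Ω → ℝ≥0∞}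
    (hJ : ∀ i (A : Set S), MeasurableSet (J i ⁻¹' A)) (hT : ∀ i, Measurable (T i))
    (A : ℕ → Set S) (x : ℕ → S) (u : ℕ → ℝ≥0) (j N : ℕ) :
    MeasurableSet {ω | (∀ i ≤ j, J i ω = x i) ∧ (∀ i, j < i → i ≤ N → J i ω ∈ A i) ∧
      ∀ i < N, (u i : ℝ≥0∞) < T i ω} := by
  have h1 : MeasurableSet (⋂ i, ⋂ _ : i ≤ j, J i ⁻¹' {x i}) :=
    MeasurableSet.iInter fun i => MeasurableSet.iInter fun _ => hJ i _
  have h2 : MeasurableSet (⋂ i, ⋂ _ : j < i, ⋂ _ : i ≤ N, J i ⁻¹' (A i)) :=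
    MeasurableSet.iInter fun i => MeasurableSet.iInter fun _ => MeasurableSet.iInter fun _ => hJ i _
  have h3 : MeasurableSet (⋂ i, ⋂ _ : i < N, {ω | (u i : ℝ≥0∞) < T i ω}) :=
    MeasurableSet.iInter fun i => MeasurableSet.iInter fun _ =>
      measurableSet_lt measurable_const (hT i)
  convert h1.inter (h2.inter h3) using 1
  ext ω
  simp

theorem hasSum_of_eq {ι : Type*} {f g : ι → ℝ} {a b : ℝ} (h : HasSum f a) (hfg : ∀ i, g i = f i)
    (hab : b = a) : HasSum g b := by
  rwa [funext hfg, hab]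

/-- The probability that the first `N` steps of the jump chain stay in prescribed sets and that the
holding times exceed prescribed bounds, when the relevant one-step probabilities are constant on
these sets. -/
theorem measure_path_mem {S Ω : Type*} [Countable S] [MeasurableSpace Ω] {P : Measure Ω}
    {Q : Matrix S S ℝ} (hQ : IsGenerator Q) {x₀ : S} {J : ℕ → Ω → S} {T : ℕ → Ω → ℝ≥0∞}
    (hJ : ∀ i (A : Set S), MeasurableSet (J i ⁻¹' A)) (hT : ∀ i, Measurable (T i))
    (hlaw : ∀ (N : ℕ) (x : ℕ → S) (u : ℕ → ℝ≥0), x 0 = x₀ →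
      P {ω | (∀ i ≤ N, J i ω = x i) ∧ ∀ i < N, (u i : ℝ≥0∞) < T i ω} =
        ENNReal.ofReal (∏ i ∈ Finset.range N,
          (Real.exp (Q (x i) (x i) * u i) * jumpProb Q (x i) (x (i + 1)))))
    (A : ℕ → Set S) (u : ℕ → ℝ≥0) (g : ℕ → ℝ)
    (hg0 : ∀ i, 0 ≤ g i)
    (hg : ∀ i, ∀ x ∈ A i,
      HasSum ((A (i + 1)).indicator fun y => Real.exp (Q x x * u i) * jumpProb Q x y) (g i))
    (d j : ℕ) (x : ℕ → S) (hx : x 0 = x₀) (hxj : x j ∈ A j) :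
    P {ω | (∀ i ≤ j, J i ω = x i) ∧ (∀ i, j < i → i ≤ j + d → J i ω ∈ A i) ∧
        ∀ i < j + d, (u i : ℝ≥0∞) < T i ω} =
      ENNReal.ofReal ((∏ i ∈ Finset.range j,
          (Real.exp (Q (x i) (x i) * u i) * jumpProb Q (x i) (x (i + 1)))) *
        ∏ i ∈ Finset.range d, g (j + i)) := by
  classical
  induction d generalizing j x with
  | zero =>
    rw [Finset.range_zero, Finset.prod_empty, mul_one, ← hlaw j x u hx]
    congr 1
    ext ω
    simp only [Set.mem_ofPred_eq, add_zero]
    refine and_congr_right fun _ => and_iff_right fun i h1 h2 => ?_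
    omega
  | succ d ih =>
    have hKnn : ∀ i y y', 0 ≤ Real.exp (Q y y * u i) * jumpProb Q y y' := fun i y y' =>
      mul_nonneg (Real.exp_pos _).le (hQ.jumpProb_nonneg _ _)
    -- Splitting by the value `y` of `J (j + 1)` lengthens the exactly prescribed path by one step,
    -- so the induction hypothesis applies to `Function.update x (j + 1) y`.
    set E : S → Set Ω := fun y => {ω | y ∈ A (j + 1) ∧
      (∀ i ≤ j + 1, J i ω = Function.update x (j + 1) y i) ∧
      (∀ i, j + 1 < i → i ≤ j + 1 + d → J i ω ∈ A i) ∧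
      ∀ i < j + 1 + d, (u i : ℝ≥0∞) < T i ω} with hE
    have hset : {ω | (∀ i ≤ j, J i ω = x i) ∧ (∀ i, j < i → i ≤ j + (d + 1) → J i ω ∈ A i) ∧
        ∀ i < j + (d + 1), (u i : ℝ≥0∞) < T i ω} = ⋃ y : S, E y := by
      ext ω
      simp only [hE, Set.mem_ofPred_eq, Set.mem_iUnion]
      constructor
      · rintro ⟨h1, h2, h3⟩
        refine ⟨J (j + 1) ω, h2 _ (by omega) (by omega), fun i hi => ?_,
          fun i h4 h5 => h2 i (by omega) (by omega), fun i hi => h3 i (by omega)⟩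
        rcases eq_or_ne i (j + 1) with rfl | hne
        · simp
        · rw [Function.update_of_ne hne]
          exact h1 i (by omega)
      · rintro ⟨y, hy, h1, h2, h3⟩
        refine ⟨fun i hi => ?_, fun i h4 h5 => ?_, fun i hi => h3 i (by omega)⟩
        · rw [h1 i (by omega), Function.update_of_ne (by omega)]
        · rcases eq_or_ne i (j + 1) with rfl | hne
          · rw [h1 _ le_rfl, Function.update_self]
            exact hy
          · exact h2 i (by omega) (by omega)
    have hmeas : ∀ y, MeasurableSet (E y) := fun y =>
      (MeasurableSet.const _).inter (measurableSet_path hJ hT A _ u _ _)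
    have hdisj : Pairwise (Function.onFun Disjoint E) := by
      intro y y' hyy'
      refine Set.disjoint_left.mpr fun ω h h' => hyy' ?_
      have h1 := h.2.1 (j + 1) le_rfl
      have h2 := h'.2.1 (j + 1) le_rfl
      rw [Function.update_self] at h1 h2
      exact h1.symm.trans h2
    set C := ∏ i ∈ Finset.range j,
      (Real.exp (Q (x i) (x i) * u i) * jumpProb Q (x i) (x (i + 1))) with hC
    have hCnn : 0 ≤ C := Finset.prod_nonneg fun i _ => hKnn _ _ _
    have hPE : ∀ y, P (E y) = ENNReal.ofReal (C * ((A (j + 1)).indicator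
        (fun y => Real.exp (Q (x j) (x j) * u j) * jumpProb Q (x j) y) y *
          ∏ i ∈ Finset.range d, g (j + 1 + i))) := by
      intro y
      by_cases hy : y ∈ A (j + 1)
      · have := ih (j + 1) (Function.update x (j + 1) y)
          (by rw [Function.update_of_ne (by omega), hx]) (by rwa [Function.update_self])
        have hEy : E y = {ω | (∀ i ≤ j + 1, J i ω = Function.update x (j + 1) y i) ∧
            (∀ i, j + 1 < i → i ≤ j + 1 + d → J i ω ∈ A i) ∧
            ∀ i < j + 1 + d, (u i : ℝ≥0∞) < T i ω} := by
          simp [hE, hy]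
        rw [hEy, this, Set.indicator_of_mem hy, Finset.prod_range_succ, Function.update_self,
          Function.update_of_ne (by omega : j ≠ j + 1), ← mul_assoc C, hC]
        congr 3
        refine Finset.prod_congr rfl fun i hi => ?_
        have := Finset.mem_range.mp hi
        rw [Function.update_of_ne (by omega), Function.update_of_ne (by omega)]
      · have hEy : E y = ∅ := by simp [hE, hy]
        simp [hEy, hy]
    have hsum := ((hg j (x j) hxj).mul_right (∏ i ∈ Finset.range d, g (j + 1 + i))).mul_left C
    rw [hset, measure_iUnion hdisj hmeas]
    simp_rw [hPE]
    rw [← ENNReal.ofReal_tsum_of_nonneg _ hsum.summable, hsum.tsum_eq, Finset.prod_range_succ']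
    · congr 2
      rw [mul_comm, add_zero]
      congr 1
      exact Finset.prod_congr rfl fun i _ => by rw [add_assoc, add_comm 1 i]
    · intro y
      exact mul_nonneg hCnn (mul_nonneg (Set.indicator_nonneg (fun _ _ => hKnn _ _ _) _)
        (Finset.prod_nonneg fun _ _ => hg0 _))

/-- Lumping: if, on a set `V` of states that is closed under transitions, every transition
changes the value of `f` and the total rate into a fibre of `f` depends only on the value of `f`,
then `f ∘ X` is again a Markov chain, and the chain almost surely never leaves `V`. -/
theorem IsCTMC.lump {S S' Ω : Type*} [Countable S] [MeasurableSpace Ω] {P : Measure Ω}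
    [IsProbabilityMeasure P] {Q : Matrix S S ℝ} {Q' : Matrix S' S' ℝ} (hQ : IsGenerator Q)
    (hQ' : IsGenerator Q') {x₀ : S} {X : ℝ≥0 → Ω → S} (hX : IsCTMC P Q x₀ X) (f : S → S')
    (V : Set S) (h₀ : x₀ ∈ V) (hdiag : ∀ x ∈ V, Q x x ≠ 0)
    (hclosed : ∀ x ∈ V, ∀ y, y ≠ x → Q x y ≠ 0 → y ∈ V ∧ f y ≠ f x)
    (hlump : ∀ x ∈ V, ∀ z, HasSum ((f ⁻¹' {z}).indicator (Q x)) (Q' (f x) z)) :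
    IsCTMC P Q' (f x₀) (fun r ω => f (X r ω)) ∧ ∀ᵐ ω ∂P, ∀ r, X r ω ∈ V := by
  classical
  obtain ⟨J, T, hJ, hT, hJ0, hlaw, hexp, hrep⟩ := hX
  -- No jump stays inside a fibre, so the diagonal entry is the only contribution to the fibre sum:
  -- the exit rates of `x` and `f x` agree.
  have hQQ' : ∀ x ∈ V, Q' (f x) (f x) = Q x x := by
    intro x hx
    refine (hlump x hx (f x)).unique ?_
    convert hasSum_ite_eq x (Q x x) using 2 with y
    by_cases hy : y = x
    · simp [hy]
    · by_cases hfy : f y = f x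
      · have : Q x y = 0 := by
          by_contra h
          exact (hclosed x hx y hy h).2 hfy
        simp [hy, this, Set.indicator]
      · simp [hy, hfy]
  have hjump0 : ∀ x ∈ V, ∀ y, y ∉ V → jumpProb Q x y = 0 := by
    intro x hx y hy
    have hne : y ≠ x := fun h => hy (h ▸ hx)
    have : Q x y = 0 := by
      by_contra h
      exact hy (hclosed x hx y hne h).1
    simp [jumpProb, hdiag x hx, hne, this]
  have hjump : ∀ x ∈ V, ∀ z,
      HasSum ((V ∩ f ⁻¹' {z}).indicator (jumpProb Q x)) (jumpProb Q' (f x) z) := by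
    intro x hx z
    have hV : (V ∩ f ⁻¹' {z}).indicator (jumpProb Q x) = (f ⁻¹' {z}).indicator (jumpProb Q x) := by
      funext y
      by_cases hy : y ∈ V
      · simp [Set.indicator, hy]
      · simp [Set.indicator, hy, hjump0 x hx y hy]
    rw [hV]
    by_cases hz : z = f x
    · subst hz
      convert hasSum_zero (α := ℝ) (β := S) using 1
      · funext y
        by_cases hy : y = x
        · simp [jumpProb, hy, hdiag x hx, Set.indicator]
        · by_cases hfy : f y = f x
          · have : Q x y = 0 := by
              by_contra h
              exact (hclosed x hx y hy h).2 hfy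
            simp [jumpProb, hy, this, Set.indicator, hdiag x hx]
          · simp [hfy]
      · simp [jumpProb, hQQ' x hx, hdiag x hx]
    · refine hasSum_of_eq ((hlump x hx z).div_const (-Q x x)) (fun y => ?_) ?_
      · by_cases hfy : f y = z
        · have hy : y ≠ x := fun h => hz (by rw [← hfy, h])
          simp [jumpProb, hdiag x hx, hfy, hy]
        · simp [hfy]
      · simp [jumpProb, hQQ' x hx, hdiag x hx, hz]
  have hrow : ∀ x ∈ V, HasSum (V.indicator (jumpProb Q x)) 1 := by
    intro x hx
    have hV : V.indicator (jumpProb Q x) = jumpProb Q x := by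
      funext y
      by_cases hy : y ∈ V
      · simp [hy]
      · simp [hy, hjump0 x hx y hy]
    rw [hV]
    refine hasSum_of_eq (((hQ.2 x).sub (hasSum_ite_eq x (Q x x))).div_const (-Q x x))
      (fun y => ?_) ?_
    · by_cases hy : y = x
      · simp [jumpProb, hy, hdiag x hx]
      · simp [jumpProb, hy, hdiag x hx]
    · rw [zero_sub, div_self (neg_ne_zero.mpr (hdiag x hx))]
  have hVae : ∀ N, ∀ᵐ ω ∂P, ∀ i ≤ N, J i ω ∈ V := by
    intro N
    -- With all sets equal to `V` and all time bounds `0`, each one-step sum is `1`, so staying in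
    -- `V` has probability one.
    have h := measure_path_mem hQ hJ hT hlaw (fun _ => V) (fun _ => 0) (fun _ => 1)
      (fun _ => zero_le_one) (fun i x hx => by simpa using hrow x hx) N 0 (fun _ => x₀) rfl h₀
    simp only [Finset.range_zero, Finset.prod_empty, Finset.prod_const_one, mul_one,
      ENNReal.ofReal_one] at h
    have hae := (mem_ae_iff_prob_eq_one₀ (μ := P) (s := {ω | _}) ?_).mpr h
    · filter_upwards [hae] with ω hω i hi
      rcases Nat.eq_zero_or_pos i with rfl | hpos
      · rw [hω.1 0 le_rfl]
        exact h₀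
      · exact hω.2.1 i hpos (by omega)
    · exact (measurableSet_path hJ hT _ _ _ _ _).nullMeasurableSet
  have hVae' : ∀ᵐ ω ∂P, ∀ i, J i ω ∈ V := by
    filter_upwards [ae_all_iff.mpr hVae] with ω hω i using hω i i le_rfl
  refine ⟨⟨fun i ω => f (J i ω), T, fun i A => hJ i (f ⁻¹' A), hT, ?_, ?_, hexp, ?_⟩, ?_⟩
  · filter_upwards [hJ0] with ω hω
    rw [hω]
  · intro N x u hx
    -- Intersecting with `V` is needed because the one-step sums are known only there; it changes
    -- the event by a null set.
    set A : ℕ → Set S := fun i => V ∩ f ⁻¹' {x i} with hA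
    have h := measure_path_mem hQ hJ hT hlaw A u
      (fun i => Real.exp (Q' (x i) (x i) * u i) * jumpProb Q' (x i) (x (i + 1)))
      (fun i => mul_nonneg (Real.exp_pos _).le (hQ'.jumpProb_nonneg _ _))
      (fun i y hy => by
        have hfy : f y = x i := hy.2
        have := (hjump y hy.1 (x (i + 1))).mul_left (Real.exp (Q y y * u i))
        rw [← hfy, hQQ' y hy.1]
        refine hasSum_of_eq this (fun y' => ?_) rfl
        simp only [hA, Set.indicator]
        split_ifs <;> simp) N 0 (fun _ => x₀) rfl ⟨h₀, hx.symm⟩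
    simp only [Finset.range_zero, Finset.prod_empty, one_mul, zero_add] at h
    rw [← h]
    refine measure_congr ?_
    filter_upwards [hVae', hJ0] with ω hω hω0
    refine propext (and_congr ?_ Iff.rfl |>.trans and_assoc)
    constructor
    · intro h1
      refine ⟨fun i hi => ?_, fun i _ hi => ⟨hω i, h1 i hi⟩⟩
      obtain rfl : i = 0 := by omega
      exact hω0
    · rintro ⟨h1, h2⟩ i hi
      rcases Nat.eq_zero_or_pos i with rfl | hpos
      · rw [h1 0 le_rfl, hx]
      · exact (h2 i hpos hi).2
  · filter_upwards [hrep] with ω hω N r h1 h2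
    rw [hω N r h1 h2]
  · filter_upwards [hrep, hexp, hVae'] with ω hω hinf hV r
    -- Since the holding times sum to infinity, every time `r` falls into some holding interval,
    -- where `X` is one of the `J N`.
    have hlt : ∃ N, (r : ℝ≥0∞) < ∑ i ∈ Finset.range N, T i ω := by
      by_contra hcon
      push Not at hcon
      have : ∑' i, T i ω ≤ r := by
        rw [ENNReal.tsum_eq_iSup_nat]
        exact iSup_le hcon
      rw [hinf] at this
      exact absurd this (by simp)
    obtain ⟨N, hN⟩ : ∃ N, Nat.find hlt = N + 1 := by
      refine Nat.exists_eq_succ_of_ne_zero fun h0 => ?_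
      have := Nat.find_spec hlt
      rw [h0] at this
      simp at this
    have h1 : ∑ i ∈ Finset.range N, T i ω ≤ r := not_lt.mp (Nat.find_min hlt (by omega))
    have h2 := Nat.find_spec hlt
    rw [hN] at h2
    rw [hω N r h1 h2]
    exact hV N

end MDSQueue

namespace MDSQueue

/-! ### The generator of the reduced process -/

section Reduced

variable {k t : ℕ}

/-- The entry `w_{j+1}` of a state, and `0` beyond the `t`-th entry. -/
def buf (y : State k t) (j : ℕ) : ℕ := if h : j < t then y.1 ⟨j, h⟩ else 0

/-- The number of nonzero entries `w_i`. -/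
def front (y : State k t) : ℕ := (Finset.univ.filter fun i => y.1 i ≠ 0).card

/-- `n + ∑ w_i - m`; this is the number of idle servers minus `k` times the number of batches
waiting behind the first `t`. -/
def excess (n : ℕ) (y : State k t) : ℤ := n + ∑ i, ((y.1 i : ℕ) : ℤ) - y.2

/-- A negative excess means that batches wait behind the first `t`; then fewer than `k` servers are
idle, and their number is the nonnegative residue modulo `k`. -/
def idleCount (n : ℕ) (y : State k t) : ℕ :=
  (if 0 ≤ excess n y then excess n y else excess n y % k).toNat

/-- The number of servers that have served the first `p` waiting batches. -/
def started (n : ℕ) (y : State k t) : ℕ → ℕ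
  | 0 => n
  | j + 1 => k - buf y j

/-- The number of busy servers that have served exactly the first `p` waiting batches. -/
def classCount (n : ℕ) (y : State k t) (p : ℕ) : ℕ :=
  if p < front y then started n y p - started n y (p + 1)
  else if p = front y then started n y p - idleCount n y else 0

/-- The truncation is harmless on visited states and makes the formulas total on the others. -/
def cap (k x : ℕ) : Fin (k + 1) := ⟨min x k, Nat.lt_succ_of_le (min_le_right _ _)⟩

/-- The entries `w_i` after an arrival. -/
def arrivalFront (n : ℕ) (y : State k t) (i : Fin t) : Fin (k + 1) :=
  -- With at least `k` idle servers the truncated difference is `0`. If `front y = t`, no index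
  -- matches and all entries stay.
  if (i : ℕ) = front y then cap k (k - idleCount n y) else y.1 i

/-- The entries `w_i` after a server that has served exactly the first `p` waiting batches
completes its job. -/
def departureFront (n : ℕ) (y : State k t) (p : ℕ) (i : Fin t) : Fin (k + 1) :=
  if p < front y then
    if p = 0 ∧ buf y 0 = 1 then
      -- The entries shift left; the former `(t+1)`-st batch, untouched so far, becomes the last
      -- reserved one and gives a job to every idle server.
      if excess n y < 0 ∧ (i : ℕ) + 1 = t then cap k (k - idleCount n y)
      else cap k (buf y (i + 1))
    else if (i : ℕ) = p then cap k (y.1 i - 1) else y.1 i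
  else y.1 i

def arrivalState (n : ℕ) (y : State k t) : State k t := (arrivalFront n y, y.2 + k)

def departureState (n : ℕ) (y : State k t) (p : ℕ) : State k t := (departureFront n y p, y.2 - 1)

open Classical in
/-- The generator of the reduced process. -/
noncomputable def reducedGenerator (n k t : ℕ) (lam mu : ℝ) : Matrix (State k t) (State k t) ℝ :=
  fun y y' =>
    lam * ((if y' = arrivalState n y then 1 else 0) - if y' = y then 1 else 0) +
      ∑ p ∈ Finset.range (t + 1), mu * classCount n y p *
        ((if y' = departureState n y p then 1 else 0) - if y' = y then 1 else 0)

variable {n : ℕ} {lam mu : ℝ}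

theorem isGenerator_reducedGenerator (hlam : 0 < lam) (hmu : 0 < mu) :
    IsGenerator (reducedGenerator n k t lam mu) := by
  classical
  refine ⟨fun y y' hne => ?_, fun y => ?_⟩
  · have h : y' ≠ y := hne.symm
    simp only [reducedGenerator, h, if_false, sub_zero]
    have h01 : ∀ (q : Prop) [Decidable q], (0 : ℝ) ≤ if q then 1 else 0 := fun q _ => by
      split_ifs <;> simp
    refine add_nonneg (mul_nonneg hlam.le (h01 _)) (Finset.sum_nonneg fun p _ => ?_)
    exact mul_nonneg (mul_nonneg hmu.le (Nat.cast_nonneg _)) (h01 _)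
  · have h1 : ∀ a : State k t, HasSum (fun y' => (if y' = a then (1 : ℝ) else 0) -
        if y' = y then 1 else 0) 0 := fun a => by
      simpa using (hasSum_ite_eq a (1 : ℝ)).sub (hasSum_ite_eq y 1)
    refine hasSum_of_eq (((h1 _).mul_left lam).add (hasSum_sum fun p _ => (h1 _).mul_left _))
      (fun y' => rfl) ?_
    simp

theorem reducedGenerator_eq_zero {y y' : State k t} (h1 : y'.2 ≠ y.2 + k) (h2 : y'.2 ≠ y.2)
    (h3 : y'.2 ≠ y.2 - 1) : reducedGenerator n k t lam mu y y' = 0 := by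
  have ha : y' ≠ arrivalState n y := fun h => h1 (by rw [h]; rfl)
  have hb : y' ≠ y := fun h => h2 (by rw [h])
  have hc : ∀ p, y' ≠ departureState n y p := fun p h => h3 (by rw [h]; rfl)
  simp [reducedGenerator, ha, hb, hc]

/-! ### Periodicity in `m` and the block structure. -/

theorem sum_front_le (w : Fin t → Fin (k + 1)) : ∑ i, ((w i : ℕ) : ℤ) ≤ t * k := by
  calc ∑ i, ((w i : ℕ) : ℤ) ≤ ∑ _i : Fin t, (k : ℤ) :=
        Finset.sum_le_sum fun i _ => by have := (w i).is_lt; omega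
    _ = t * k := by simp

/-- In this range the excess is below `k`, where both branches of `idleCount` give the residue
modulo `k`; raising `m` by `k` lowers the excess by `k`. -/
theorem idleCount_shift (hk : 1 ≤ k) (hkn : k ≤ n) (w : Fin t → Fin (k + 1)) {m : ℕ}
    (hm : n - k + 1 + t * k ≤ m) :
    idleCount n ((w, m + k) : State k t) = idleCount n ((w, m) : State k t) := by
  have h := sum_front_le w
  have hm' : (n : ℤ) - k + 1 + t * k ≤ m := by
    have : ((n - k + 1 + t * k : ℕ) : ℤ) ≤ m := by exact_mod_cast hm
    push_cast [Nat.cast_sub hkn] at this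
    exact this
  have key : ∀ y : State k t, excess n y < k → idleCount n y = (excess n y % k).toNat := by
    intro y hy
    unfold idleCount
    split_ifs with h0
    · rw [Int.emod_eq_of_lt h0 hy]
    · rfl
  have he : excess n ((w, m + k) : State k t) = excess n ((w, m) : State k t) - k := by
    simp only [excess]
    push_cast
    ring
  have hlt : excess n ((w, m) : State k t) < k := by
    simp only [excess]
    linarith
  rw [key _ hlt, key _ (by rw [he]; linarith [Int.natCast_nonneg k]), he, Int.sub_emod_right]

/-- Apart from `idleCount`, `m` enters only through the sign of the excess, and only when `w_1 = 1`.
Then `∑ w_i ≤ (t - 1) k + 1`, so the strict bound on `m` makes the excess negative on both sides. -/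
theorem departureFront_shift (hk : 1 ≤ k) (hkn : k ≤ n) (w : Fin t → Fin (k + 1)) {m : ℕ}
    (hm : n - k + 1 + t * k < m) (p : ℕ) :
    departureFront n ((w, m + k) : State k t) p = departureFront n ((w, m) : State k t) p := by
  funext i
  have hb : ∀ j, buf ((w, m + k) : State k t) j = buf ((w, m) : State k t) j := fun _ => rfl
  have hf : front ((w, m + k) : State k t) = front ((w, m) : State k t) := rfl
  simp only [departureFront, hb, hf, idleCount_shift hk hkn w hm.le]
  by_cases h1 : buf ((w, m) : State k t) 0 = 1
  · have ht : 0 < t := by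
      by_contra h0
      simp [buf, h0] at h1
    have hw : (w ⟨0, ht⟩ : ℕ) = 1 := by simpa [buf, ht] using h1
    have hsum : ∑ i, ((w i : ℕ) : ℤ) ≤ t * k - k + 1 := by
      rw [← Finset.add_sum_erase _ _ (Finset.mem_univ (⟨0, ht⟩ : Fin t)), hw]
      have : ∑ i ∈ Finset.univ.erase (⟨0, ht⟩ : Fin t), ((w i : ℕ) : ℤ) ≤
          ∑ i ∈ Finset.univ.erase (⟨0, ht⟩ : Fin t), (k : ℤ) :=
        Finset.sum_le_sum fun i _ => by have := (w i).is_lt; omega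
      rw [Finset.sum_const, Finset.card_erase_of_mem (Finset.mem_univ _), Finset.card_univ,
        Fintype.card_fin, nsmul_eq_mul, Nat.cast_sub (by omega)] at this
      push_cast at this ⊢
      linarith
    have hm' : (n : ℤ) - k + 1 + t * k < m := by
      have : ((n - k + 1 + t * k : ℕ) : ℤ) < m := by exact_mod_cast hm
      push_cast [Nat.cast_sub hkn] at this
      exact this
    have e1 : excess n ((w, m) : State k t) < 0 := by
      simp only [excess]
      linarith
    have e2 : excess n ((w, m + k) : State k t) < 0 := by
      simp only [excess] at e1 ⊢
      push_cast
      linarith [Int.natCast_nonneg k]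
    simp only [e1, e2]
  · simp [h1]

theorem reducedGenerator_shift (hk : 1 ≤ k) (hkn : k ≤ n) (w w' : Fin t → Fin (k + 1)) {m m' : ℕ}
    (hm : n - k + 1 + t * k ≤ m) (hm' : n - k + 1 + t * k ≤ m') :
    reducedGenerator n k t lam mu (w, m + k) (w', m' + k) =
      reducedGenerator n k t lam mu (w, m) (w', m') := by
  have h1 : (((w', m' + k) : State k t) = (w, m + k)) ↔ (((w', m') : State k t) = (w, m)) := by
    simp
  have h2 : (((w', m' + k) : State k t) = arrivalState n (w, m + k)) ↔
      (((w', m') : State k t) = arrivalState n (w, m)) := by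
    have : arrivalFront n ((w, m + k) : State k t) = arrivalFront n ((w, m) : State k t) := by
      funext i
      simp only [arrivalFront, idleCount_shift hk hkn w hm]
      rfl
    simp [arrivalState, this]
  have h3 : ∀ p, (((w', m' + k) : State k t) = departureState n (w, m + k) p) ↔
      (((w', m') : State k t) = departureState n (w, m) p) := by
    intro p
    simp only [departureState, Prod.mk.injEq]
    by_cases hlt : n - k + 1 + t * k < m
    · rw [departureFront_shift hk hkn w hlt]
      exact and_congr_right fun _ => by omega
    -- At the lowest `m` of level `0` a departure would go to the boundary, which `hm'` excludes;
    -- both sides are false.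
    · constructor <;> rintro ⟨-, h⟩ <;> omega
  have h4 : ∀ p, classCount n ((w, m + k) : State k t) p = classCount n ((w, m) : State k t) p := by
    intro p
    have hs : started n ((w, m + k) : State k t) = started n ((w, m) : State k t) := by
      funext j
      cases j <;> rfl
    simp only [classCount, idleCount_shift hk hkn w hm, hs]
    rfl
  simp only [reducedGenerator, h1, h2, h3, h4]

theorem reducedGenerator_shift_mul (hk : 1 ≤ k) (hkn : k ≤ n) (w w' : Fin t → Fin (k + 1))
    {m m' : ℕ} (hm : n - k + 1 + t * k ≤ m) (hm' : n - k + 1 + t * k ≤ m') (i : ℕ) :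
    reducedGenerator n k t lam mu (w, m + i * k) (w', m' + i * k) =
      reducedGenerator n k t lam mu (w, m) (w', m') := by
  induction i with
  | zero => simp
  | succ i ih =>
    rw [← ih, add_mul, one_mul, ← add_assoc, ← add_assoc]
    exact reducedGenerator_shift hk hkn w w' (by omega) (by omega)

theorem stateOf_bijective (hk : 1 ≤ k) : Function.Bijective (stateOf n k t) := by
  constructor
  · rintro (⟨w, m⟩ | ⟨i, w, r⟩) (⟨w', m'⟩ | ⟨i', w', r'⟩) h <;>
      simp only [stateOf, Prod.mk.injEq] at h
    · obtain ⟨rfl, h⟩ := h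
      rw [Fin.ext h]
    · have := m.is_lt
      have := h.2
      have : (t + i') * k = t * k + i' * k := add_mul _ _ _
      omega
    · have := m'.is_lt
      have := h.2
      have : (t + i) * k = t * k + i * k := add_mul _ _ _
      omega
    · obtain ⟨rfl, h⟩ := h
      have h1 : (t + i) * k = t * k + i * k := add_mul _ _ _
      have h2 : (t + i') * k = t * k + i' * k := add_mul _ _ _
      have h3 : i * k + r = i' * k + r' := by omega
      have hi : i = i' := by
        have := congrArg (· / k) h3
        simpa [Nat.mul_comm _ k, Nat.mul_add_div (show 0 < k by omega),
          Nat.div_eq_of_lt r.is_lt, Nat.div_eq_of_lt r'.is_lt] using this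
      subst hi
      rw [Fin.ext (by omega : (r : ℕ) = r')]
  · rintro ⟨w, m⟩
    by_cases hm : m < n - k + t * k + 1
    · exact ⟨.inl (w, ⟨m, hm⟩), rfl⟩
    · refine ⟨.inr ((m - (n - k + t * k + 1)) / k,
        (w, ⟨(m - (n - k + t * k + 1)) % k, Nat.mod_lt _ (by omega)⟩)), ?_⟩
      simp only [stateOf, Prod.mk.injEq, true_and]
      have h1 := add_mul t ((m - (n - k + t * k + 1)) / k) k
      have h2 := Nat.div_add_mod' (m - (n - k + t * k + 1)) k
      omega

theorem isQBD_reducedGenerator (hk : 1 ≤ k) (hkn : k ≤ n) (hlam : 0 < lam) (hmu : 0 < mu) :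
    IsQBD (stateOf n k t) (reducedGenerator n k t lam mu) := by
  refine ⟨stateOf_bijective hk, isGenerator_reducedGenerator hlam hmu, ?_⟩
  set Q := reducedGenerator n k t lam mu with hQ
  set e := stateOf n k t with he
  -- The blocks are read off from the boundary and levels `0` and `1`; periodicity carries them to
  -- all other levels.
  refine ⟨fun l b => Q (e (.inr (0, l))) (e (.inl b)), fun b b' => Q (e (.inl b)) (e (.inl b')),
    fun b l => Q (e (.inl b)) (e (.inr (0, l))), fun l l' => Q (e (.inr (1, l))) (e (.inr (0, l'))),
    fun l l' => Q (e (.inr (0, l))) (e (.inr (0, l'))),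
    fun l l' => Q (e (.inr (0, l))) (e (.inr (1, l'))), ?_⟩
  have hshift : ∀ i a b l l', Q (e (.inr (a + i, l))) (e (.inr (b + i, l'))) =
      Q (e (.inr (a, l))) (e (.inr (b, l'))) := by
    rintro i a b ⟨w, r⟩ ⟨w', r'⟩
    have h := reducedGenerator_shift_mul (lam := lam) (mu := mu) hk hkn w w'
      (m := n - k + 1 + (t + a) * k + r) (m' := n - k + 1 + (t + b) * k + r')
      (by rw [add_mul]; omega) (by rw [add_mul]; omega) i
    simp only [he, stateOf, hQ]
    refine Eq.trans ?_ h
    congr 2 <;> ring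
  have hmul : ∀ a b : ℕ, (a + b) * k = a * k + b * k := fun a b => add_mul a b k
  ext x x'
  rcases x with ⟨w, m⟩ | ⟨i, w, r⟩ <;> rcases x' with ⟨w', m'⟩ | ⟨j, w', r'⟩ <;>
    simp only [Matrix.submatrix_apply, qbdMatrix]
  · split_ifs with h
    · rw [h]
    · have h2 := Nat.le_mul_of_pos_left k (Nat.pos_of_ne_zero h)
      have h1 := hmul t j
      have h4 := r'.is_lt
      have h3 := m.is_lt
      apply reducedGenerator_eq_zero <;> simp only [he, stateOf] <;> omega
  · split_ifs with h
    · rw [h]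
    · have h2 := Nat.le_mul_of_pos_left k (Nat.pos_of_ne_zero h)
      have h1 := hmul t i
      have h4 := r.is_lt
      have h3 := m'.is_lt
      apply reducedGenerator_eq_zero <;> simp only [he, stateOf] <;> omega
  · split_ifs with h1 h2 h3
    · have := hshift i 0 1 (w, r) (w', r')
      rw [← this, h1, zero_add, add_comm 1 i]
    · have := hshift i 0 0 (w, r) (w', r')
      rw [← this, h2, zero_add]
    · have := hshift j 1 0 (w, r) (w', r')
      rw [← this, h3, zero_add, add_comm 1 j]
    -- Levels at distance two or more differ in `m` by at least `k + 1`, more than any jump.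
    · have e1 := hmul t i
      have e2 := hmul t j
      have e3 := r.is_lt
      have e4 := r'.is_lt
      rcases le_or_gt (i + 2) j with h | h
      · obtain ⟨d, rfl⟩ := Nat.exists_eq_add_of_le h
        have e5 := hmul (i + 2) d
        have e6 := hmul i 2
        apply reducedGenerator_eq_zero <;> simp only [he, stateOf] <;> omega
      · obtain ⟨d, rfl⟩ := Nat.exists_eq_add_of_le (show j + 2 ≤ i by omega)
        have e5 := hmul (j + 2) d
        have e6 := hmul j 2
        apply reducedGenerator_eq_zero <;> simp only [he, stateOf] <;> omega

end Reduced

end MDSQueue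

namespace MDSQueue

/-! ### Configurations in which the servers are classified by the number of batches served -/

section Classified

variable {n : ℕ}

/-- The number of servers whose class exceeds `j`. -/
def countAbove (p : Fin n → ℕ) (j : ℕ) : ℕ := (Finset.univ.filter fun s => j < p s).card

/-- The `j`-th waiting batch when server `s` has served exactly the first `p s` waiting batches, and
is processing a job of the last of these if it belongs to `β`. -/
def classBatch (p : Fin n → ℕ) (β : Finset (Fin n)) (j : ℕ) : Batch n where
  done := Finset.univ.filter fun s => j < p s ∧ ¬(s ∈ β ∧ p s = j + 1)
  active := Finset.univ.filter fun s => s ∈ β ∧ p s = j + 1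

/-- The configuration with `b` waiting batches and set `β` of busy servers in which server `s` has
served exactly the first `p s` waiting batches. -/
def classConfig (b : ℕ) (p : Fin n → ℕ) (β : Finset (Fin n)) : Config n where
  waiting := (List.range b).map (classBatch p β)
  other := β.filter fun s => p s = 0

/-- The classes after the servers in `A` have received a job of the `i`-th waiting batch. -/
def assignClass (i : ℕ) (A : Finset (Fin n)) (p : Fin n → ℕ) (s : Fin n) : ℕ :=
  if s ∈ A then i + 1 else p s

variable {b : ℕ} {p : Fin n → ℕ} {β : Finset (Fin n)}

theorem mem_served_classBatch {j : ℕ} {s : Fin n} :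
    s ∈ (classBatch p β j).served ↔ j < p s := by
  simp only [Batch.served, classBatch, Finset.mem_union, Finset.mem_filter, Finset.mem_univ,
    true_and]
  constructor
  · rintro (h | h) <;> omega
  · intro h
    by_cases h' : s ∈ β ∧ p s = j + 1
    · exact Or.inr h'
    · exact Or.inl ⟨h, h'⟩

theorem inBuffer_classBatch (k j : ℕ) : (classBatch p β j).inBuffer k = k - countAbove p j := by
  unfold Batch.inBuffer countAbove
  rw [← Finset.card_union_of_disjoint]
  · congr 2
    ext s
    simpa [Batch.served] using mem_served_classBatch (p := p) (β := β) (j := j) (s := s)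
  · rw [Finset.disjoint_left]
    intro s h1 h2
    simp only [classBatch, Finset.mem_filter] at h1 h2
    exact h1.2.2 h2.2

theorem Config.mem_busy (c : Config n) (s : Fin n) :
    s ∈ c.busy ↔ s ∈ c.other ∨ ∃ x ∈ c.waiting, s ∈ x.active := by
  have h : ∀ L : List (Batch n), s ∈ L.foldr (fun b A => b.active ∪ A) c.other ↔
      s ∈ c.other ∨ ∃ x ∈ L, s ∈ x.active := by
    intro L
    induction L with
    | nil => simp
    | cons x L ih =>
      simp only [List.foldr_cons, Finset.mem_union, ih, List.mem_cons, exists_eq_or_imp]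
      tauto
  exact h _

theorem busy_classConfig (hp : ∀ s, p s ≤ b) : (classConfig b p β).busy = β := by
  ext s
  simp only [Config.mem_busy, classConfig, Finset.mem_filter, List.mem_map, List.mem_range,
    exists_exists_and_eq_and, classBatch, Finset.mem_univ, true_and]
  constructor
  · rintro (h | ⟨_, _, h⟩)
    exacts [h.1, h.1]
  · intro h
    rcases Nat.eq_zero_or_pos (p s) with h0 | h0
    · exact Or.inl ⟨h, h0⟩
    · exact Or.inr ⟨p s - 1, by have := hp s; omega, h, by omega⟩

theorem idle_classConfig (hp : ∀ s, p s ≤ b) : (classConfig b p β).idle = βᶜ := by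
  rw [Config.idle, busy_classConfig hp]

theorem length_classConfig : (classConfig b p β).waiting.length = b := by simp [classConfig]

theorem Batch.ext' {x y : Batch n} (h1 : ∀ s, s ∈ x.done ↔ s ∈ y.done)
    (h2 : ∀ s, s ∈ x.active ↔ s ∈ y.active) : x = y := by
  cases x
  cases y
  simp only [Batch.mk.injEq]
  exact ⟨Finset.ext h1, Finset.ext h2⟩

theorem Config.ext' {c d : Config n} (h1 : c.waiting = d.waiting)
    (h2 : ∀ s, s ∈ c.other ↔ s ∈ d.other) : c = d := by
  cases c
  cases d
  simp only [Config.mk.injEq]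
  exact ⟨h1, Finset.ext h2⟩

/-- In `classBatch`, a server that has served a batch counts as done unless it is busy with it, so a
completion alters no class. -/
theorem release_classConfig {s : Fin n} (hs : s ∈ β) :
    (classConfig b p β).release s = classConfig b p (β.erase s) := by
  refine Config.ext' ?_ fun s' => ?_
  · simp only [Config.release, classConfig, List.map_map]
    refine List.map_congr_left fun j _ => ?_
    simp only [Function.comp]
    split_ifs with h
    · simp only [classBatch, Finset.mem_filter, Finset.mem_univ, true_and] at h
      refine Batch.ext' (fun s' => ?_) (fun s' => ?_) <;> by_cases he : s' = s <;>
        simp [classBatch, he, h]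
    · have h' : p s ≠ j + 1 := by simpa [classBatch, hs] using h
      refine Batch.ext' (fun s' => ?_) (fun s' => ?_) <;> by_cases he : s' = s <;>
        simp [classBatch, he, h']
  · simp only [Config.release, classConfig, Finset.mem_erase, Finset.mem_filter]
    tauto

theorem classBatch_assignClass {i : ℕ} {A : Finset (Fin n)} (hA : ∀ s ∈ A, p s = i ∧ s ∉ β)
    (j : ℕ) : classBatch (assignClass i A p) (β ∪ A) j =
      ⟨(classBatch p β j).done, (classBatch p β j).active ∪ if j = i then A else ∅⟩ := by
  refine Batch.ext' (fun s => ?_) (fun s => ?_) <;> by_cases hs : s ∈ A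
  · have := hA s hs
    simp only [classBatch, assignClass, Finset.mem_filter, Finset.mem_univ, true_and, hs,
      Finset.mem_union, this, if_true]
    simp
    omega
  · simp [classBatch, assignClass, hs]
  · have := hA s hs
    by_cases hj : j = i
    · simp [classBatch, assignClass, hs, hj]
    · simp [classBatch, assignClass, hs, this, hj]
      omega
  · by_cases hj : j = i <;> simp [classBatch, assignClass, hs, hj]

theorem mem_other_assignClass {i : ℕ} {A : Finset (Fin n)} (hA : ∀ s ∈ A, p s = i ∧ s ∉ β)
    (s : Fin n) : s ∈ (β ∪ A).filter (fun s => assignClass i A p s = 0) ↔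
      s ∈ β.filter fun s => p s = 0 := by
  rw [Finset.mem_filter, Finset.mem_filter, Finset.mem_union, assignClass]
  by_cases hs : s ∈ A
  · simp [hs, (hA s hs).2]
  · simp [hs]

/-- The prefix structure survives because each recipient has served exactly the first `i` batches.
Being idle, it has its earlier jobs recorded as done, so raising its class affects only batch `i`.
-/
theorem assign_classConfig {i : ℕ} {A : Finset (Fin n)} (hA : ∀ s ∈ A, p s = i ∧ s ∉ β) :
    (classConfig b p β).assign i A = classConfig b (assignClass i A p) (β ∪ A) := by
  refine Config.ext' ?_ fun s => (mem_other_assignClass hA s).symm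
  refine List.ext_getElem (by simp [Config.assign, classConfig]) fun j h1 h2 => ?_
  simp only [Config.assign, classConfig, List.getElem_modify, List.getElem_map,
    List.getElem_range, classBatch_assignClass hA]
  by_cases hj : j = i
  · simp [hj]
  · simp [hj, Ne.symm hj]

theorem append_classConfig {A : Finset (Fin n)} (hp : ∀ s, p s ≤ b)
    (hA : ∀ s ∈ A, p s = b ∧ s ∉ β) :
    (classConfig b p β).append A = classConfig (b + 1) (assignClass b A p) (β ∪ A) := by
  refine Config.ext' ?_ fun s => (mem_other_assignClass hA s).symm
  simp only [Config.append, classConfig, List.range_succ, List.map_append, List.map_cons,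
    List.map_nil]
  congr 1
  · refine List.map_congr_left fun j hj => ?_
    have hj' : j ≠ b := by
      have := List.mem_range.mp hj
      omega
    rw [classBatch_assignClass hA]
    simp [hj']
  · rw [classBatch_assignClass hA]
    congr 1
    refine Batch.ext' (fun s => ?_) (fun s => ?_) <;> have := hp s <;> simp [classBatch] <;> omega

theorem append_empty_classConfig (hp : ∀ s, p s ≤ b) :
    (classConfig b p β).append ∅ = classConfig (b + 1) p β := by
  rw [append_classConfig hp (by simp), Finset.union_empty]
  congr 1

theorem settle_classConfig {k : ℕ} (h : ∀ j < b, countAbove p j < k) :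
    (classConfig b p β).settle k = classConfig b p β := by
  have h' : ∀ x ∈ (classConfig b p β).waiting, x.inBuffer k ≠ 0 := by
    intro x hx
    simp only [classConfig, List.mem_map, List.mem_range] at hx
    obtain ⟨j, hj, rfl⟩ := hx
    rw [inBuffer_classBatch]
    have := h j hj
    omega
  refine Config.ext' (List.filter_eq_self.mpr (by simpa using h')) fun s => ?_
  simp only [Config.settle]
  rw [List.filter_eq_nil_iff.mpr (by simpa using h')]
  rfl

/-- When the first batch leaves the buffer, prefixes shorten by one. Truncated subtraction is right:
classes `0` and `1` both become servers that have served no waiting batch. -/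
theorem settle_classConfig_succ {k : ℕ} (h0 : k ≤ countAbove p 0)
    (h : ∀ j < b, countAbove p (j + 1) < k) :
    (classConfig (b + 1) p β).settle k = classConfig b (fun s => p s - 1) β := by
  set L := (List.range b).map fun j => classBatch p β (j + 1) with hL
  have hw : (classConfig (b + 1) p β).waiting = classBatch p β 0 :: L := by
    simp [classConfig, List.range_succ_eq_map, hL, Function.comp_def]
  have h' : ∀ x ∈ L, x.inBuffer k ≠ 0 := by
    intro x hx
    simp only [hL, List.mem_map, List.mem_range] at hx
    obtain ⟨j, hj, rfl⟩ := hx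
    rw [inBuffer_classBatch]
    have := h j hj
    omega
  have h00 : (classBatch p β 0).inBuffer k = 0 := by
    rw [inBuffer_classBatch]
    omega
  refine Config.ext' ?_ fun s => ?_
  · simp only [Config.settle, hw]
    rw [List.filter_cons_of_neg (by simpa using h00), List.filter_eq_self.mpr (by simpa using h')]
    refine List.map_congr_left fun j hj => ?_
    refine Batch.ext' (fun s => ?_) (fun s => ?_) <;>
      simp only [classBatch, Finset.mem_filter, Finset.mem_univ, true_and]
    · have e1 : j + 1 < p s ↔ j < p s - 1 := by omega
      have e2 : p s = j + 1 + 1 ↔ p s - 1 = j + 1 := by omega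
      rw [e1, e2]
    · have e2 : p s = j + 1 + 1 ↔ p s - 1 = j + 1 := by omega
      rw [e2]
  · simp only [Config.settle, hw]
    rw [List.filter_cons_of_pos (by simpa using h00),
      List.filter_eq_nil_iff.mpr (by simpa using h')]
    simp only [List.foldr_cons, List.foldr_nil, classBatch, classConfig, Finset.mem_union,
      Finset.mem_filter, Finset.mem_univ, true_and]
    have e : p s - 1 = 0 ↔ p s = 1 ∨ p s = 0 := by omega
    rw [e]
    tauto

theorem findIdx?_classConfig (s : Fin n) :
    (classConfig b p β).waiting.findIdx? (fun x => s ∉ x.served) =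
      if p s < b then some (p s) else none := by
  have hserved : ∀ j, decide (s ∉ (classBatch p β j).served) = decide (p s ≤ j) := fun j => by
    simp [mem_served_classBatch]
  split_ifs with h
  · rw [List.findIdx?_eq_some_iff_getElem]
    refine ⟨by simpa [classConfig] using h, ?_, fun j hj => ?_⟩
    · simp [classConfig, mem_served_classBatch]
    · simpa [classConfig, mem_served_classBatch] using hj
  · rw [List.findIdx?_eq_none_iff]
    intro x hx
    simp only [classConfig, List.mem_map, List.mem_range] at hx
    obtain ⟨j, hj, rfl⟩ := hx
    simp only [mem_served_classBatch, not_lt, decide_eq_false_iff_not, not_le]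
    omega

/-! ### Counting servers by class, and counting jobs. -/

theorem countAbove_assignClass {i : ℕ} {A : Finset (Fin n)} (hA : ∀ s ∈ A, p s = i) (j : ℕ) :
    countAbove (assignClass i A p) j = countAbove p j + if j = i then A.card else 0 := by
  unfold countAbove
  by_cases hj : j = i
  · subst hj
    rw [if_pos rfl, ← Finset.card_union_of_disjoint]
    · congr 1
      ext s
      rw [Finset.mem_filter, Finset.mem_union, Finset.mem_filter, assignClass]
      by_cases hs : s ∈ A <;> simp [hs]
    · rw [Finset.disjoint_left]
      intro s h1 h2
      have := hA s h2
      simp only [Finset.mem_filter] at h1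
      omega
  · rw [if_neg hj, add_zero]
    congr 1
    ext s
    rw [Finset.mem_filter, Finset.mem_filter, assignClass]
    by_cases hs : s ∈ A
    · have := hA s hs
      simp [hs]
      omega
    · simp [hs]

theorem countAbove_sub_one (j : ℕ) : countAbove (fun s => p s - 1) j = countAbove p (j + 1) := by
  unfold countAbove
  congr 1
  ext s
  simp
  omega

/-- The server `s` itself witnesses strictness. This is why only the first waiting batch can lose
its last buffered job. -/
theorem countAbove_lt {i j : ℕ} {s : Fin n} (h1 : i < p s) (h2 : p s ≤ j) :
    countAbove p j < countAbove p i := by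
  refine Finset.card_lt_card ⟨fun s hs => ?_, fun h => ?_⟩
  · simp only [Finset.mem_filter, Finset.mem_univ, true_and] at hs ⊢
    omega
  · have := h (by simpa using h1 : s ∈ _)
    simp only [Finset.mem_filter, Finset.mem_univ, true_and] at this
    omega

theorem countAbove_eq_zero {j : ℕ} (h : ∀ s, p s ≤ j) : countAbove p j = 0 := by
  simp [countAbove, h]

theorem sum_countAbove (hp : ∀ s, p s ≤ b) :
    ∑ j ∈ Finset.range b, countAbove p j = ∑ s, p s := by
  simp only [countAbove, Finset.card_filter]
  rw [Finset.sum_comm]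
  refine Finset.sum_congr rfl fun s _ => ?_
  rw [← Finset.card_filter]
  have : (Finset.range b).filter (fun j => j < p s) = Finset.range (p s) := by
    ext j
    have := hp s
    simp
    omega
  rw [this, Finset.card_range]

theorem jobs_classConfig (k : ℕ) (hp : ∀ s, p s ≤ b) :
    (classConfig b p β).jobs k = ∑ j ∈ Finset.range b, (k - countAbove p j) + β.card := by
  rw [Config.jobs, busy_classConfig hp]
  congr 1
  simp only [classConfig, List.map_map, Finset.sum, Finset.range_val, Multiset.range]
  simp [Function.comp_def, inBuffer_classBatch]

/-- Conservation: the `k * b` jobs of the waiting batches are either buffered or started, and `∑ s,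
p s` counts the started ones. Tracking `m` reduces to tracking `b`, `∑ s, p s` and `β.card`. -/
theorem jobs_add_sum_classConfig {k : ℕ} (hp : ∀ s, p s ≤ b) (h : ∀ j < b, countAbove p j ≤ k) :
    (classConfig b p β).jobs k + ∑ s, p s = k * b + β.card := by
  rw [jobs_classConfig k hp, ← sum_countAbove hp, add_right_comm, ← Finset.sum_add_distrib,
    Finset.sum_congr rfl fun j hj => Nat.sub_add_cancel (h j (Finset.mem_range.mp hj))]
  simp [mul_comm]

theorem sum_assignClass {i : ℕ} {A : Finset (Fin n)} (hA : ∀ s ∈ A, p s = i) :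
    ∑ s, assignClass i A p s = ∑ s, p s + A.card := by
  have : ∀ s, assignClass i A p s = p s + if s ∈ A then 1 else 0 := fun s => by
    by_cases hs : s ∈ A
    · simp [assignClass, hs, hA s hs]
    · simp [assignClass, hs]
  simp [this, Finset.sum_add_distrib]

theorem reducedState_classConfig (k t : ℕ) :
    reducedState k t (classConfig b p β) =
      (fun i : Fin t => cap k (if (i : ℕ) < b then k - countAbove p i else 0),
        (classConfig b p β).jobs k) := by
  unfold reducedState
  congr 1
  funext i
  by_cases h : (i : ℕ) < b
  · simp [classConfig, h, inBuffer_classBatch, cap]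
  · simp [classConfig, h, cap]

end Classified

end MDSQueue

namespace MDSQueue

/-! ### The reachable configurations -/

section Admissible

variable {n k t b : ℕ} {p : Fin n → ℕ} {β : Finset (Fin n)}

/-- The invariant of the MDS-Reservation(`t`) policy: only the first `t` waiting batches are
served, and every idle server has served all of these. -/
structure Admissible (k t b : ℕ) (p : Fin n → ℕ) (β : Finset (Fin n)) : Prop where
  le_length : ∀ s, p s ≤ b
  le_reserved : ∀ s, p s ≤ t
  idle_eq : ∀ s, s ∉ β → p s = min b t
  countAbove_lt : ∀ j < b, countAbove p j < k
  idle_lt_of_zero : t = 0 → 0 < b → (βᶜ).card < k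

/-- For `t ≥ 1`, all idle servers have served batch `min b t - 1`, which still has a buffered job
and so was started by fewer than `k` servers. -/
theorem Admissible.idle_lt (h : Admissible k t b p β) (hb : 0 < b) : (βᶜ).card < k := by
  rcases Nat.eq_zero_or_pos t with ht | ht
  · exact h.idle_lt_of_zero ht hb
  · refine lt_of_le_of_lt (Finset.card_le_card fun s hs => ?_)
      (h.countAbove_lt (min b t - 1) (by omega))
    have := h.idle_eq s (by simpa using hs)
    simp only [Finset.mem_filter, Finset.mem_univ, true_and]
    omega

theorem Admissible.jobs_add_sum (h : Admissible k t b p β) :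
    (classConfig b p β).jobs k + ∑ s, p s = k * b + β.card :=
  jobs_add_sum_classConfig h.le_length fun j hj => (h.countAbove_lt j hj).le

/-! ### Reading the configuration off the reduced state. -/

theorem val_cap (x : ℕ) : ((cap k x : Fin (k + 1)) : ℕ) = min x k := rfl

theorem buf_reducedState (j : ℕ) : buf (reducedState k t (classConfig b p β)) j =
    if j < t ∧ j < b then k - countAbove p j else 0 := by
  rw [reducedState_classConfig, buf]
  by_cases h : j < t
  · by_cases hb : j < b <;> simp [h, hb, val_cap]
  · simp [h]

theorem Admissible.front_reducedState (h : Admissible k t b p β) :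
    front (reducedState k t (classConfig b p β)) = min b t := by
  rw [reducedState_classConfig, front]
  have : ∀ i : Fin t, cap k (if (i : ℕ) < b then k - countAbove p i else 0) ≠ 0 ↔ (i : ℕ) < b := by
    intro i
    rw [Ne, Fin.ext_iff, val_cap]
    split_ifs with hi
    · have := h.countAbove_lt i hi
      simp
      omega
    · simp [hi]
  simp only [this]
  rw [Fin.card_filter_val_lt, min_comm]

/-- The jobs in service and the first `t` buffer entries cancel against `m`; each batch behind the
first `t` is untouched and keeps all its `k` jobs. -/
theorem Admissible.excess_reducedState (h : Admissible k t b p β) :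
    excess n (reducedState k t (classConfig b p β)) =
      ((βᶜ).card : ℤ) - ((k * (b - t) : ℕ) : ℤ) := by
  rw [reducedState_classConfig, excess, jobs_classConfig k h.le_length]
  set g : ℕ → ℕ := fun j => if j < b then k - countAbove p j else 0 with hg
  have h1 : ∑ i : Fin t, ((cap k (g i) : ℕ) : ℤ) = ((∑ j ∈ Finset.range t, g j : ℕ) : ℤ) := by
    rw [← Fin.sum_univ_eq_sum_range, Nat.cast_sum]
    refine Finset.sum_congr rfl fun i _ => ?_
    rw [val_cap, min_eq_left]
    simp only [hg]
    split_ifs <;> omega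
  have h2 : ∑ j ∈ Finset.range b, (k - countAbove p j) = ∑ j ∈ Finset.range b, g j :=
    Finset.sum_congr rfl fun j hj => by simp [hg, Finset.mem_range.mp hj]
  have h3 : ∑ j ∈ Finset.range b, g j = ∑ j ∈ Finset.range t, g j + k * (b - t) := by
    rcases le_total b t with hbt | hbt
    · rw [Nat.sub_eq_zero_of_le hbt, mul_zero, add_zero]
      refine Finset.sum_subset (Finset.range_mono hbt) fun j _ hj => ?_
      have : ¬ j < b := by simpa using hj
      simp [hg, this]
    · obtain ⟨d, rfl⟩ := Nat.exists_eq_add_of_le hbt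
      rw [Finset.sum_range_add, Nat.add_sub_cancel_left]
      congr 1
      rw [Finset.sum_congr rfl (g := fun _ => k)]
      · simp [mul_comm]
      · intro j hj
        have hj' := Finset.mem_range.mp hj
        simp only [hg]
        rw [if_pos (by omega), countAbove_eq_zero fun s => (h.le_reserved s).trans (by omega)]
        rfl
  have h4 := Finset.card_add_card_compl β
  rw [Fintype.card_fin] at h4
  change (n : ℤ) + ∑ i : Fin t, ((cap k (g i) : ℕ) : ℤ) - _ = _
  rw [h1, h2, h3]
  push_cast
  omega

theorem Admissible.le_mul_and_idle_lt (h : Admissible k t b p β) (hb : t < b) : k ≤ k * (b - t) ∧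
    (βᶜ).card < k :=
  ⟨Nat.le_mul_of_pos_right k (by omega), h.idle_lt (by omega)⟩

theorem Admissible.excess_neg_iff (h : Admissible k t b p β) :
    excess n (reducedState k t (classConfig b p β)) < 0 ↔ t < b := by
  rw [h.excess_reducedState]
  constructor
  · intro h0
    by_contra hb
    rw [Nat.sub_eq_zero_of_le (not_lt.mp hb)] at h0
    simp at h0
    omega
  · intro hb
    have := h.le_mul_and_idle_lt hb
    omega

theorem Admissible.idleCount_reducedState (h : Admissible k t b p β) :
    idleCount n (reducedState k t (classConfig b p β)) = (βᶜ).card := by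
  rw [idleCount]
  split_ifs with h0
  · have hb : b ≤ t := by
      by_contra hb
      have := h.excess_neg_iff.mpr (not_le.mp hb)
      omega
    rw [h.excess_reducedState, Nat.sub_eq_zero_of_le hb]
    simp
  · have hb := h.excess_neg_iff.mp (not_le.mp h0)
    rw [h.excess_reducedState]
    push_cast
    rw [Int.sub_mul_emod_self_left, Int.emod_eq_of_lt (by omega)
      (by have := h.le_mul_and_idle_lt hb; omega)]
    simp

/-- Class sizes are differences of consecutive prefix counts. Idle servers all lie in the top class
`min b t`, so only there must they be subtracted. -/
theorem Admissible.classCount_reducedState (h : Admissible k t b p β) (q : ℕ) :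
    classCount n (reducedState k t (classConfig b p β)) q =
      (β.filter fun s => p s = q).card := by
  have hs : ∀ q ≤ min b t, started n (reducedState k t (classConfig b p β)) q =
      (Finset.univ.filter fun s => q ≤ p s).card := by
    intro q hq
    cases q with
    | zero => simp [started]
    | succ j =>
      have := h.countAbove_lt j (by omega)
      rw [started, buf_reducedState, if_pos (by omega), Nat.sub_sub_self this.le]
      rfl
  rw [classCount, h.front_reducedState, h.idleCount_reducedState]
  split_ifs with h1 h2
  · rw [hs q h1.le, hs (q + 1) h1, ← Finset.card_sdiff_of_subset]
    · congr 1
      ext s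
      simp only [Finset.mem_sdiff, Finset.mem_filter, Finset.mem_univ, true_and]
      constructor
      · intro hq
        refine ⟨?_, by omega⟩
        by_contra hβ
        have := h.idle_eq s hβ
        omega
      · rintro ⟨-, hq⟩
        omega
    · intro s hs
      simp only [Finset.mem_filter, Finset.mem_univ, true_and] at hs ⊢
      omega
  · rw [hs q h2.le, ← Finset.card_sdiff_of_subset]
    · congr 1
      ext s
      have := h.le_length s
      have := h.le_reserved s
      simp only [Finset.mem_sdiff, Finset.mem_filter, Finset.mem_univ, true_and,
        Finset.mem_compl, not_not]
      constructor
      · rintro ⟨h3, h4⟩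
        exact ⟨h4, by omega⟩
      · rintro ⟨h3, h4⟩
        exact ⟨h4.ge, h3⟩
    · intro s hs
      have := h.idle_eq s (by simpa using hs)
      simp only [Finset.mem_filter, Finset.mem_univ, true_and]
      omega
  · symm
    rw [Finset.card_eq_zero, Finset.filter_eq_empty_iff]
    intro s _
    have := h.le_length s
    have := h.le_reserved s
    omega

/-- The number of waiting batches. -/
def batchCount (n : ℕ) (y : State k t) : ℕ :=
  if 0 ≤ excess n y then front y else t + ((idleCount n y - excess n y) / k).toNat

/-- The description of the system in terms of the reduced state. -/
def recover (n : ℕ) (y : State k t) : Description where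
  jobs := y.2
  idle := idleCount n y
  batches := (List.range (batchCount n y)).map fun j =>
    (classCount n y (j + 1), if j < t then buf y j else k)

theorem Admissible.batchCount_reducedState (hk : 1 ≤ k) (h : Admissible k t b p β) :
    batchCount n (reducedState k t (classConfig b p β)) = b := by
  rw [batchCount]
  split_ifs with h0
  · have hb : b ≤ t := by
      by_contra hb
      have := h.excess_neg_iff.mpr (not_le.mp hb)
      omega
    rw [h.front_reducedState, min_eq_left hb]
  · have hb := h.excess_neg_iff.mp (not_le.mp h0)
    rw [h.excess_reducedState, h.idleCount_reducedState, sub_sub_cancel]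
    push_cast
    rw [Int.mul_ediv_cancel_left _ (by omega), Int.toNat_natCast]
    omega

/-- A server is processing a job of batch `j` exactly when it is busy and of class `j + 1`. -/
theorem Admissible.describe_eq (hk : 1 ≤ k) (h : Admissible k t b p β) :
    describe k (classConfig b p β) = recover n (reducedState k t (classConfig b p β)) := by
  unfold describe recover
  rw [idle_classConfig h.le_length, h.idleCount_reducedState, h.batchCount_reducedState hk]
  congr 1
  simp only [classConfig, List.map_map]
  refine List.map_congr_left fun j hj => ?_
  have hj' := List.mem_range.mp hj
  have h1 := h.classCount_reducedState (j + 1)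
  have h2 := buf_reducedState (k := k) (t := t) (b := b) (p := p) (β := β) j
  simp only [classConfig] at h1 h2
  rw [h1, h2]
  simp only [Function.comp, inBuffer_classBatch]
  congr 1
  · congr 1
    ext s
    simp [classBatch]
  · by_cases hjt : j < t
    · simp [hjt, hj']
    · simp [hjt, countAbove_eq_zero fun s => (h.le_reserved s).trans (not_lt.mp hjt)]

end Admissible

end MDSQueue

namespace MDSQueue

/-! ### Effect of one arrival or completion. -/

section Steps

variable {n k t b : ℕ} {p : Fin n → ℕ} {β : Finset (Fin n)}

/-- The configurations that satisfy the invariant of the policy. -/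
def admissibleConfigs (n k t : ℕ) : Set (Config n) :=
  {c | ∃ b p β, Admissible k t b p β ∧ c = classConfig b p β}

theorem card_add_card_compl_fin (β : Finset (Fin n)) : β.card + (βᶜ).card = n := by
  rw [Finset.card_add_card_compl, Fintype.card_fin]

theorem Admissible.reducedState_eq_arrivalState (h : Admissible k t b p β) {b' : ℕ}
    {p' : Fin n → ℕ} {β' : Finset (Fin n)}
    (hjobs : (classConfig b' p' β').jobs k = (classConfig b p β).jobs k + k)
    (hfront : ∀ j < t, (if j < b' then k - countAbove p' j else 0) =
      if j = min b t then k - (βᶜ).card else if j < b then k - countAbove p j else 0) :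
    reducedState k t (classConfig b' p' β') =
      arrivalState n (reducedState k t (classConfig b p β)) := by
  unfold arrivalState arrivalFront
  rw [h.front_reducedState, h.idleCount_reducedState, reducedState_classConfig,
    reducedState_classConfig, hjobs]
  refine Prod.ext (funext fun i => ?_) rfl
  simp only [hfront i i.is_lt]
  split_ifs <;> rfl

theorem Admissible.reducedState_eq_departureState (h : Admissible k t b p β) {b' q : ℕ}
    {p' : Fin n → ℕ} {β' : Finset (Fin n)}
    (hjobs : (classConfig b' p' β').jobs k + 1 = (classConfig b p β).jobs k)
    (hfront : ∀ j < t, (if j < b' then k - countAbove p' j else 0) =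
      if q < min b t then
        if q = 0 ∧ k - countAbove p 0 = 1 then
          if t < b ∧ j + 1 = t then k - (βᶜ).card
          else if j + 1 < t ∧ j + 1 < b then k - countAbove p (j + 1) else 0
        else if j = q then k - countAbove p j - 1
        else if j < b then k - countAbove p j else 0
      else if j < b then k - countAbove p j else 0) :
    reducedState k t (classConfig b' p' β') =
      departureState n (reducedState k t (classConfig b p β)) q := by
  unfold departureState
  refine Prod.ext (funext fun i => ?_) ?_
  · simp only [departureFront, h.front_reducedState, h.excess_neg_iff, h.idleCount_reducedState,
      buf_reducedState]
    rw [reducedState_classConfig, reducedState_classConfig]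
    simp only [hfront i i.is_lt]
    by_cases hq : q < min b t
    · have hq' : 0 < t ∧ 0 < b := by omega
      rw [if_pos hq, if_pos hq, if_pos hq']
      by_cases hlast : q = 0 ∧ k - countAbove p 0 = 1
      · rw [if_pos hlast, if_pos hlast]
        split_ifs <;> rfl
      · rw [if_neg hlast, if_neg hlast]
        by_cases hiq : (i : ℕ) = q
        · rw [if_pos hiq, if_pos hiq, if_pos (by omega : (i : ℕ) < b), val_cap,
            min_eq_left (Nat.sub_le _ _)]
        · rw [if_neg hiq, if_neg hiq]
    · simp only [hq, if_false]
  · rw [reducedState_classConfig, reducedState_classConfig]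
    change (classConfig b' p' β').jobs k = (classConfig b p β).jobs k - 1
    omega

theorem Admissible.arrival_support (hk : 1 ≤ k) (h : Admissible k t b p β) (sel : Selection n k)
    {c' : Config n} (hc' : c' ∈ (arrival t sel (classConfig b p β)).support) :
    c' ∈ admissibleConfigs n k t ∧
      reducedState k t c' = arrivalState n (reducedState k t (classConfig b p β)) := by
  have hjobs := h.jobs_add_sum
  have hcard := card_add_card_compl_fin β
  unfold arrival at hc'
  rw [length_classConfig, idle_classConfig h.le_length] at hc'
  split_ifs at hc' with hcond
  · rw [PMF.mem_support_map_iff] at hc'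
    obtain ⟨A, hA, rfl⟩ := hc'
    obtain ⟨hA1, hA2⟩ := sel.spec _ A hA
    rw [idle_classConfig h.le_length] at hA1 hA2
    have hAβ : ∀ s ∈ A, s ∉ β := fun s hs => by simpa using hA1 hs
    have hunion : (β ∪ A).card = β.card + A.card :=
      Finset.card_union_of_disjoint (Finset.disjoint_right.mpr hAβ)
    have hA3 : ∀ s ∈ A, p s = b ∧ s ∉ β := fun s hs => by
      refine ⟨?_, hAβ s hs⟩
      have := h.idle_eq s (hAβ s hs)
      have := h.idle_lt
      omega
    have hA4 : ∀ s ∈ A, p s = b := fun s hs => (hA3 s hs).1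
    have hle : ∀ s, assignClass b A p s ≤ b + 1 := fun s => by
      have := h.le_length s
      unfold assignClass
      split_ifs <;> omega
    have hsum := sum_assignClass hA4
    rw [append_classConfig h.le_length hA3]
    -- With `k` or more idle servers the buffer must be empty, and the new batch leaves it at once.
    -- Otherwise all idle servers take a job and the rule has no choice.
    rcases le_or_gt k (βᶜ).card with hz | hz
    · obtain rfl : b = 0 := by
        by_contra hb
        have := h.idle_lt (Nat.pos_of_ne_zero hb)
        omega
      have hp0 : ∀ s, assignClass 0 A p s - 1 = 0 := fun s => by
        have := hle s
        omega
      rw [settle_classConfig_succ (by rw [countAbove_assignClass hA4]; simp; omega)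
        (fun j hj => absurd hj (Nat.not_lt_zero j))]
      have hadm : Admissible k t 0 (fun s => assignClass 0 A p s - 1) (β ∪ A) :=
        { le_length := fun s => (hp0 s).le
          le_reserved := fun s => by rw [hp0 s]; exact Nat.zero_le t
          idle_eq := fun s _ => by rw [hp0 s, Nat.zero_min]
          countAbove_lt := fun j hj => absurd hj (Nat.not_lt_zero j)
          idle_lt_of_zero := fun _ hb => absurd hb (lt_irrefl 0) }
      have hjobs' := hadm.jobs_add_sum
      refine ⟨⟨_, _, _, hadm, rfl⟩, h.reducedState_eq_arrivalState ?_ fun j hj => ?_⟩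
      · have hp : ∑ s, p s = 0 := Finset.sum_eq_zero fun s _ => Nat.le_zero.mp (h.le_length s)
        have hp' : ∑ s, (assignClass 0 A p s - 1) = 0 := Finset.sum_eq_zero fun s _ => hp0 s
        omega
      · simp
        omega
    · have hAeq : A = βᶜ := Finset.eq_of_subset_of_card_le hA1 (by omega)
      have hbt : b < t := by omega
      have hcount : ∀ j, countAbove (assignClass b A p) j =
          countAbove p j + if j = b then A.card else 0 := countAbove_assignClass hA4
      have hNb : countAbove p b = 0 := countAbove_eq_zero h.le_length
      have hlt : ∀ j < b + 1, countAbove (assignClass b A p) j < k := fun j hj => by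
        rw [hcount]
        split_ifs with hjb
        · rw [hjb, hNb]
          omega
        · have := h.countAbove_lt j (by omega)
          omega
      rw [settle_classConfig hlt]
      have hadm : Admissible k t (b + 1) (assignClass b A p) (β ∪ A) :=
        { le_length := hle
          le_reserved := fun s => (hle s).trans hbt
          idle_eq := fun s hs => by simp [hAeq] at hs
          countAbove_lt := hlt
          idle_lt_of_zero := fun ht => by omega }
      have hjobs' := hadm.jobs_add_sum
      refine ⟨⟨_, _, _, hadm, rfl⟩, h.reducedState_eq_arrivalState ?_ fun j hj => ?_⟩
      · rw [mul_add] at hjobs'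
        omega
      · rw [hcount, min_eq_left hbt.le]
        by_cases hjb : j = b
        · simp [hjb, hNb, hAeq]
        · by_cases hjb' : j < b
          · simp [hjb, hjb', hjb'.trans (Nat.lt_succ_self b)]
          · simp [hjb, hjb', show ¬ j < b + 1 by omega]
  · rw [PMF.mem_support_pure_iff] at hc'
    subst hc'
    rw [append_empty_classConfig h.le_length]
    have hadm : Admissible k t (b + 1) p β :=
      { le_length := fun s => (h.le_length s).trans (Nat.le_succ b)
        le_reserved := h.le_reserved
        idle_eq := fun s hs => by rw [h.idle_eq s hs]; omega
        countAbove_lt := fun j hj => by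
          rcases Nat.lt_succ_iff_lt_or_eq.mp hj with hj | rfl
          · exact h.countAbove_lt j hj
          · rw [countAbove_eq_zero h.le_length]
            omega
        idle_lt_of_zero := fun ht _ => by omega }
    have hjobs' := hadm.jobs_add_sum
    refine ⟨⟨_, _, _, hadm, rfl⟩, h.reducedState_eq_arrivalState ?_ fun j hj => ?_⟩
    · rw [mul_add] at hjobs'
      omega
    · rw [if_pos (by omega), if_neg (by omega), if_pos (by omega)]

theorem card_compl_erase {s : Fin n} (hs : s ∈ β) : ((β.erase s)ᶜ).card = (βᶜ).card + 1 := by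
  have h1 := Finset.card_add_card_compl (β.erase s)
  have h2 := Finset.card_add_card_compl β
  have h3 := Finset.card_erase_add_one hs
  omega

theorem Admissible.departureZero_support (h : Admissible k 0 b p β) (sel : Selection n k)
    {s : Fin n} (hs : s ∈ β) {c' : Config n}
    (hc' : c' ∈ (departureZero sel s (classConfig b p β)).support) :
    c' ∈ admissibleConfigs n k 0 ∧
      reducedState k 0 c' = departureState n (reducedState k 0 (classConfig b p β)) (p s) := by
  have hjobs := h.jobs_add_sum
  have hcard := card_add_card_compl_fin β
  have hcard' := Finset.card_erase_add_one hs
  have hp0 : ∀ s, p s = 0 := fun s => Nat.le_zero.mp (h.le_reserved s)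
  have hidle := card_compl_erase hs
  unfold departureZero at hc'
  simp only [release_classConfig hs, idle_classConfig h.le_length] at hc'
  split_ifs at hc' with hcond
  · rw [PMF.mem_support_map_iff] at hc'
    obtain ⟨A, hA, rfl⟩ := hc'
    obtain ⟨hA1, hA2⟩ := sel.spec _ A hA
    rw [idle_classConfig h.le_length] at hA1 hA2
    have hb : b ≠ 0 := fun hb => hcond.2 (by simp [hb, classConfig])
    obtain ⟨b, rfl⟩ := Nat.exists_eq_succ_of_ne_zero hb
    have hlt := h.idle_lt (Nat.succ_pos b)
    -- Fewer than `k` servers were idle before the completion, so now exactly `k` are, and all of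
    -- them start the batch.
    have hAeq : A = (β.erase s)ᶜ := Finset.eq_of_subset_of_card_le hA1 (by omega)
    have hA3 : ∀ s' ∈ A, p s' = 0 ∧ s' ∉ β.erase s := fun s' hs' =>
      ⟨hp0 s', Finset.mem_compl.mp (hA1 hs')⟩
    have hA4 : ∀ s' ∈ A, p s' = 0 := fun s' hs' => hp0 s'
    have hcount : ∀ j, countAbove (assignClass 0 A p) j =
        countAbove p j + if j = 0 then A.card else 0 := countAbove_assignClass hA4
    rw [assign_classConfig hA3]
    have hN0 : ∀ j, countAbove p j = 0 := fun j =>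
      countAbove_eq_zero fun s => (hp0 s).trans_le (Nat.zero_le j)
    rw [settle_classConfig_succ (by rw [hcount, if_pos rfl]; omega)
      (fun j _ => by rw [hcount, if_neg (by omega), hN0]; omega)]
    have hp0' : ∀ s', assignClass 0 A p s' - 1 = 0 := fun s' => by
      unfold assignClass
      rw [hp0]
      split_ifs <;> rfl
    have hadm : Admissible k 0 b (fun s' => assignClass 0 A p s' - 1) (β.erase s ∪ A) :=
      { le_length := fun s' => by rw [hp0']; exact Nat.zero_le b
        le_reserved := fun s' => (hp0' s').le
        idle_eq := fun s' _ => by rw [hp0', min_eq_right (Nat.zero_le b)]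
        countAbove_lt := fun j _ => by
          rw [countAbove_eq_zero fun s => (hp0' s).trans_le (Nat.zero_le j)]
          omega
        idle_lt_of_zero := fun _ _ => by
          rw [hAeq, Finset.union_compl, Finset.compl_univ, Finset.card_empty]
          omega }
    have hjobs' := hadm.jobs_add_sum
    refine ⟨⟨_, _, _, hadm, rfl⟩,
      h.reducedState_eq_departureState ?_ fun j hj => absurd hj (Nat.not_lt_zero j)⟩
    have hunion : (β.erase s ∪ A).card = n := by
      rw [hAeq, Finset.union_compl, Finset.card_univ, Fintype.card_fin]
    have hs0 : ∑ s', p s' = 0 := Finset.sum_eq_zero fun s' _ => hp0 s'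
    have hs0' : ∑ s', (assignClass 0 A p s' - 1) = 0 := Finset.sum_eq_zero fun s' _ => hp0' s'
    rw [Nat.succ_eq_add_one] at *
    rw [mul_add] at hjobs
    omega
  · rw [PMF.mem_support_pure_iff] at hc'
    subst hc'
    have hadm : Admissible k 0 b p (β.erase s) :=
      { le_length := h.le_length
        le_reserved := h.le_reserved
        idle_eq := fun s' _ => by rw [hp0, min_eq_right (Nat.zero_le b)]
        countAbove_lt := h.countAbove_lt
        idle_lt_of_zero := fun _ hb => by
          by_contra hcon
          refine hcond ⟨not_lt.mp hcon, fun hnil => ?_⟩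
          have := congrArg List.length hnil
          rw [length_classConfig, List.length_nil] at this
          omega }
    have hjobs' := hadm.jobs_add_sum
    refine ⟨⟨_, _, _, hadm, rfl⟩,
      h.reducedState_eq_departureState ?_ fun j hj => absurd hj (Nat.not_lt_zero j)⟩
    omega

theorem head?_classConfig (hb : 0 < b) :
    (classConfig b p β).waiting.head? = some (classBatch p β 0) := by
  obtain ⟨b, rfl⟩ := Nat.exists_eq_succ_of_ne_zero hb.ne'
  simp [classConfig, List.range_succ_eq_map]

theorem Admissible.departureSucc_support (ht : 1 ≤ t) (h : Admissible k t b p β)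
    (sel : Selection n k) {s : Fin n} (hs : s ∈ β) {c' : Config n}
    (hc' : c' ∈ (departureSucc t sel s (classConfig b p β)).support) :
    c' ∈ admissibleConfigs n k t ∧
      reducedState k t c' = departureState n (reducedState k t (classConfig b p β)) (p s) := by
  have hjobs := h.jobs_add_sum
  have hcard := card_add_card_compl_fin β
  have hcard' := Finset.card_erase_add_one hs
  have hps := h.le_length s
  have hps' := h.le_reserved s
  unfold departureSucc at hc'
  simp only [release_classConfig hs, findIdx?_classConfig] at hc'
  by_cases hq : p s < min b t
  swap
  · -- the server becomes idle
    have hc'' : c' ∈ (PMF.pure (classConfig b p (β.erase s))).support := by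
      by_cases hb : p s < b
      · simpa only [hb, if_true, show ¬ p s < t by omega, if_false] using hc'
      · simpa only [hb, if_false] using hc'
    rw [PMF.mem_support_pure_iff] at hc''
    subst hc''
    have hadm : Admissible k t b p (β.erase s) :=
      { le_length := h.le_length
        le_reserved := h.le_reserved
        idle_eq := fun s' hs' => by
          by_cases he : s' = s
          · rw [he]
            omega
          · exact h.idle_eq s' fun hβ => hs' (Finset.mem_erase.mpr ⟨he, hβ⟩)
        countAbove_lt := h.countAbove_lt
        idle_lt_of_zero := fun ht' => by omega }
    have hjobs' := hadm.jobs_add_sum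
    refine ⟨⟨_, _, _, hadm, rfl⟩, h.reducedState_eq_departureState (by omega) fun j hj => ?_⟩
    rw [if_neg hq]
  -- the server takes a job of the first batch that it has not served
  set p₁ := assignClass (p s) {s} p with hp₁
  have hA : ∀ s' ∈ ({s} : Finset (Fin n)), p s' = p s ∧ s' ∉ β.erase s := fun s' hs' => by
    rw [Finset.mem_singleton.mp hs']
    exact ⟨rfl, Finset.notMem_erase s β⟩
  have hβ : β.erase s ∪ {s} = β := by
    rw [Finset.union_comm, ← Finset.insert_eq, Finset.insert_erase hs]
  have hcount : ∀ j, countAbove p₁ j = countAbove p j + if j = p s then 1 else 0 :=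
    countAbove_assignClass fun s' hs' => (hA s' hs').1
  have hsum : ∑ s', p₁ s' = ∑ s', p s' + 1 := sum_assignClass fun s' hs' => (hA s' hs').1
  have hp₁s : p₁ s = p s + 1 := by simp [hp₁, assignClass]
  have hp₁ne : ∀ s', s' ≠ s → p₁ s' = p s' := fun s' hs' => by simp [hp₁, assignClass, hs']
  have hle₁ : ∀ s', p₁ s' ≤ min b t := fun s' => by
    by_cases he : s' = s
    · rw [he, hp₁s]
      omega
    · rw [hp₁ne s' he]
      have := h.le_length s'
      have := h.le_reserved s'
      omega
  have hidle₁ : ∀ s', s' ∉ β → p₁ s' = min b t := fun s' hs' => by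
    rw [hp₁ne s' (fun he => hs' (he ▸ hs))]
    exact h.idle_eq s' hs'
  have hle₁b : ∀ s', p₁ s' ≤ b := fun s' => (hle₁ s').trans (min_le_left _ _)
  have hjobs₁ : (classConfig b p₁ β).jobs k + ∑ s', p₁ s' = k * b + β.card :=
    jobs_add_sum_classConfig hle₁b fun j hj => by
      have := h.countAbove_lt j hj
      rw [hcount]
      split_ifs <;> omega
  have hb0 : 0 < b := by omega
  simp only [show p s < b by omega, show p s < t by omega, if_true, assign_classConfig hA, hβ,
    length_classConfig, head?_classConfig hb0, Option.map_some, inBuffer_classBatch,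
    Option.some.injEq] at hc'
  rw [← hp₁] at hc'
  by_cases hlast : p s = 0 ∧ k - countAbove p 0 = 1
  · -- the first batch leaves the buffer
    obtain ⟨b, rfl⟩ := Nat.exists_eq_succ_of_ne_zero hb0.ne'
    rw [Nat.succ_eq_add_one] at *
    have hN0 : countAbove p₁ 0 = k := by
      rw [hcount, if_pos hlast.1.symm]
      omega
    have hNsucc : ∀ j, countAbove p₁ (j + 1) = countAbove p (j + 1) := fun j => by
      rw [hcount, if_neg (by omega), add_zero]
    -- Removing a batch with an empty buffer share does not change the number of jobs.
    have hshift : ∀ (p' : Fin n → ℕ) (β' : Finset (Fin n)), (∀ s, p' s ≤ b + 1) →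
        countAbove p' 0 = k → (classConfig b (fun s => p' s - 1) β').jobs k =
          (classConfig (b + 1) p' β').jobs k := by
      intro p' β' hp' h0
      rw [jobs_classConfig k hp', jobs_classConfig k (fun s => by have := hp' s; omega),
        Finset.sum_range_succ', h0]
      simp [countAbove_sub_one]
    by_cases htb : t < b + 1
    · rw [if_pos ⟨hlast.1, hlast.2, htb⟩, PMF.mem_support_map_iff] at hc'
      obtain ⟨A, hAs, rfl⟩ := hc'
      obtain ⟨hA1, hA2⟩ := sel.spec _ A hAs
      rw [idle_classConfig hle₁b] at hA1 hA2
      have hlt := h.idle_lt hb0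
      have hAeq : A = βᶜ := Finset.eq_of_subset_of_card_le hA1 (by omega)
      have hA3 : ∀ s' ∈ A, p₁ s' = t ∧ s' ∉ β := fun s' hs' => by
        have h1 : s' ∉ β := by simpa using hA1 hs'
        refine ⟨?_, h1⟩
        rw [hidle₁ s' h1]
        omega
      have hA4 : ∀ s' ∈ A, p₁ s' = t := fun s' hs' => (hA3 s' hs').1
      have hβA : β ∪ A = Finset.univ := by rw [hAeq, Finset.union_compl]
      rw [assign_classConfig hA3, hβA]
      -- The new reserved batch still has position `t`, as the first batch is removed only
      -- afterwards. Classes reach `t + 1` for the moment and drop back to at most `t`.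
      set p₂ := assignClass t A p₁ with hp₂
      have hcount₂ : ∀ j, countAbove p₂ j = countAbove p₁ j + if j = t then A.card else 0 :=
        countAbove_assignClass hA4
      have hsum₂ : ∑ s', p₂ s' = ∑ s', p₁ s' + A.card := sum_assignClass hA4
      have hle₂ : ∀ s', p₂ s' ≤ t + 1 := fun s' => by
        have := hle₁ s'
        simp only [hp₂, assignClass]
        split_ifs <;> omega
      have hNt : countAbove p₁ t = 0 :=
        countAbove_eq_zero fun s' => (hle₁ s').trans (min_le_right _ _)
      have hN₂ : ∀ j < b, countAbove p₂ (j + 1) < k := fun j hj => by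
        rw [hcount₂]
        split_ifs with hjt
        · rw [hjt, hNt]
          omega
        · rw [hNsucc]
          exact h.countAbove_lt _ (by omega)
      have hN₂0 : countAbove p₂ 0 = k := by
        rw [hcount₂, if_neg (by omega), hN0, add_zero]
      rw [settle_classConfig_succ hN₂0.ge hN₂]
      have hadm : Admissible k t b (fun s' => p₂ s' - 1) Finset.univ :=
        { le_length := fun s' => by have := hle₂ s'; omega
          le_reserved := fun s' => by have := hle₂ s'; omega
          idle_eq := fun s' hs' => absurd (Finset.mem_univ s') hs'
          countAbove_lt := fun j hj => by
            rw [countAbove_sub_one]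
            exact hN₂ j hj
          idle_lt_of_zero := fun ht' => by omega }
      have hjobs₂ : (classConfig (b + 1) p₂ Finset.univ).jobs k + ∑ s', p₂ s' =
          k * (b + 1) + (Finset.univ : Finset (Fin n)).card :=
        jobs_add_sum_classConfig (fun s' => (hle₂ s').trans (by omega)) fun j hj => by
          cases j with
          | zero => exact hN₂0.le
          | succ j => exact (hN₂ j (by omega)).le
      rw [Finset.card_univ, Fintype.card_fin] at hjobs₂
      have hsh := hshift p₂ Finset.univ (fun s' => (hle₂ s').trans (by omega)) hN₂0
      refine ⟨⟨_, _, _, hadm, rfl⟩, h.reducedState_eq_departureState ?_ fun j hj => ?_⟩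
      · rw [hsh]
        omega
      · rw [if_pos hq, if_pos hlast, countAbove_sub_one, hcount₂, if_pos (by omega : j < b)]
        by_cases hjt : j + 1 = t
        · rw [if_pos hjt, if_pos ⟨htb, hjt⟩, hjt, hNt, zero_add, hAeq]
        · rw [if_neg hjt, if_neg (fun h' => hjt h'.2), if_pos (by omega), hNsucc, add_zero]
    · rw [if_neg (fun h' => htb h'.2.2), PMF.mem_support_pure_iff] at hc'
      subst hc'
      have hN₁ : ∀ j < b, countAbove p₁ (j + 1) < k := fun j hj => by
        rw [hNsucc]
        exact h.countAbove_lt _ (by omega)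
      rw [settle_classConfig_succ hN0.ge hN₁]
      have hadm : Admissible k t b (fun s' => p₁ s' - 1) β :=
        { le_length := fun s' => by have := hle₁ s'; omega
          le_reserved := fun s' => by have := hle₁ s'; omega
          idle_eq := fun s' hs' => by rw [hidle₁ s' hs']; omega
          countAbove_lt := fun j hj => by
            rw [countAbove_sub_one]
            exact hN₁ j hj
          idle_lt_of_zero := fun ht' => by omega }
      have hsh := hshift p₁ β hle₁b hN0
      refine ⟨⟨_, _, _, hadm, rfl⟩, h.reducedState_eq_departureState ?_ fun j hj => ?_⟩
      · rw [hsh]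
        omega
      · rw [if_pos hq, if_pos hlast, countAbove_sub_one, hNsucc]
        simp only [htb, false_and, if_false]
        by_cases hjb : j < b
        · rw [if_pos hjb, if_pos (by omega)]
        · rw [if_neg hjb, if_neg (by omega)]
  · rw [if_neg (fun h' => hlast ⟨h'.1, h'.2.1⟩), PMF.mem_support_pure_iff] at hc'
    subst hc'
    have hN₁ : ∀ j < b, countAbove p₁ j < k := fun j hj => by
      have hj' := h.countAbove_lt j hj
      rw [hcount]
      split_ifs with hjq
      · rcases Nat.eq_zero_or_pos (p s) with h0 | h0
        · rw [hjq, h0] at hj' ⊢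
          by_contra hcon
          exact hlast ⟨h0, by omega⟩
        -- The previous batch has been started by strictly more servers, yet fewer than `k`, so one
        -- further start cannot exhaust this batch.
        · have h1 : countAbove p j < countAbove p (p s - 1) :=
            MDSQueue.countAbove_lt (s := s) (by omega) hjq.ge
          have h2 := h.countAbove_lt (p s - 1) (by omega)
          omega
      · exact hj'
    rw [settle_classConfig hN₁]
    have hadm : Admissible k t b p₁ β :=
      { le_length := hle₁b
        le_reserved := fun s' => (hle₁ s').trans (min_le_right _ _)
        idle_eq := hidle₁
        countAbove_lt := hN₁
        idle_lt_of_zero := fun ht' => by omega }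
    refine ⟨⟨_, _, _, hadm, rfl⟩, h.reducedState_eq_departureState (by omega) fun j hj => ?_⟩
    rw [if_pos hq, if_neg hlast, hcount]
    by_cases hjq : j = p s
    · rw [if_pos (by omega), if_pos hjq, if_pos hjq, Nat.sub_sub]
    · rw [if_neg hjq, if_neg hjq, add_zero]

theorem Admissible.departure_support (h : Admissible k t b p β) (sel : Selection n k) {s : Fin n}
    (hs : s ∈ β) {c' : Config n} (hc' : c' ∈ (departure t sel s (classConfig b p β)).support) :
    c' ∈ admissibleConfigs n k t ∧
      reducedState k t c' = departureState n (reducedState k t (classConfig b p β)) (p s) := by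
  unfold departure at hc'
  split_ifs at hc' with ht
  · subst ht
    exact h.departureZero_support sel hs hc'
  · exact h.departureSucc_support (Nat.one_le_iff_ne_zero.mpr ht) sel hs hc'

end Steps

end MDSQueue

namespace MDSQueue

/-! ### The configuration process -/

section Queue

variable {n k t : ℕ} {lam mu : ℝ}

instance (n : ℕ) : Countable (Batch n) :=
  Function.Injective.countable (f := fun x : Batch n => (x.done, x.active)) fun x y h => by
    cases x
    cases y
    simpa using h

instance (n : ℕ) : Countable (Config n) :=
  Function.Injective.countable (f := fun c : Config n => (c.waiting, c.other)) fun c d h => by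
    cases c
    cases d
    simpa using h

theorem hasSum_toReal {α : Type*} (q : PMF α) : HasSum (fun a => (q a).toReal) 1 := by
  have h := ENNReal.hasSum_toReal (f := fun a => q a) (by rw [q.tsum_coe]; simp)
  rwa [← ENNReal.tsum_toReal_eq q.apply_ne_top, q.tsum_coe, ENNReal.toReal_one] at h

open Classical in
-- A random step all of whose outcomes share one reduced state is deterministic after projection.
theorem hasSum_indicator_toReal {α γ : Type*} (q : PMF α) (f : α → γ) (z : γ)
    (h : ∀ a ∈ q.support, f a = z) (z' : γ) :
    HasSum ((f ⁻¹' {z'}).indicator fun a => (q a).toReal) (if z' = z then 1 else 0) := by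
  have h0 : ∀ a, f a ≠ z → (q a).toReal = 0 := fun a ha => by
    rw [(q.apply_eq_zero_iff a).mpr fun hs => ha (h a hs), ENNReal.toReal_zero]
  by_cases hz : z' = z
  · rw [if_pos hz]
    refine hasSum_of_eq (hasSum_toReal q) (fun a => ?_) rfl
    by_cases ha : f a = z
    · rw [Set.indicator_of_mem (by simp [ha, hz])]
    · rw [Set.indicator_of_notMem (by simp [ha, hz]), h0 a ha]
  · rw [if_neg hz]
    refine hasSum_of_eq hasSum_zero (fun a => ?_) rfl
    by_cases ha : f a = z'
    · rw [Set.indicator_of_mem (by simp [ha]), h0 a (by rw [ha]; exact hz)]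
    · rw [Set.indicator_of_notMem (by simp [ha])]

theorem isGenerator_queueGenerator (hlam : 0 < lam) (hmu : 0 < mu) (sel : Selection n k) :
    IsGenerator (queueGenerator t lam mu sel) := by
  refine ⟨fun c c' hne => ?_, fun c => ?_⟩
  · have h0 : (PMF.pure c c').toReal = 0 := by simp [PMF.pure_apply, hne.symm]
    simp only [queueGenerator, h0, sub_zero]
    exact add_nonneg (mul_nonneg hlam.le ENNReal.toReal_nonneg)
      (Finset.sum_nonneg fun s _ => mul_nonneg hmu.le ENNReal.toReal_nonneg)
  · have h1 : ∀ q : PMF (Config n),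
        HasSum (fun c' => (q c').toReal - (PMF.pure c c').toReal) 0 := fun q => by
      simpa using (hasSum_toReal q).sub (hasSum_toReal (PMF.pure c))
    refine hasSum_of_eq (((h1 _).mul_left lam).add (hasSum_sum fun s _ => (h1 _).mul_left mu))
      (fun c' => rfl) ?_
    simp

theorem jobs_pos_of_busy {b : ℕ} {p : Fin n → ℕ} {β : Finset (Fin n)} (hp : ∀ s, p s ≤ b)
    {s : Fin n} (hs : s ∈ β) : 0 < (classConfig b p β).jobs k := by
  rw [jobs_classConfig k hp]
  have := Finset.card_pos.mpr ⟨s, hs⟩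
  omega

theorem arrivalState_ne (hk : 1 ≤ k) (y : State k t) : arrivalState n y ≠ y := fun h => by
  have h2 : y.2 + k = y.2 := congrArg Prod.snd h
  omega

theorem departureState_ne {y : State k t} (hy : 0 < y.2) (q : ℕ) : departureState n y q ≠ y :=
  fun h => by
    have h2 : y.2 - 1 = y.2 := congrArg Prod.snd h
    omega

/-- Arrivals raise `m` by `k ≥ 1`, and completions lower a positive `m` by one. Stating `hc'` as an
implication covers targets outside the invariant set as well as targets with the same reduced state.
-/
theorem Admissible.jump_eq_zero (hk : 1 ≤ k) {b : ℕ} {p : Fin n → ℕ} {β : Finset (Fin n)}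
    (h : Admissible k t b p β) (sel : Selection n k) {c' : Config n}
    (hc' : c' ∈ admissibleConfigs n k t →
      reducedState k t c' = reducedState k t (classConfig b p β)) :
    (arrival t sel (classConfig b p β) c').toReal = 0 ∧
      ∀ s ∈ β, (departure t sel s (classConfig b p β) c').toReal = 0 := by
  constructor
  · rw [(PMF.apply_eq_zero_iff _ _).mpr, ENNReal.toReal_zero]
    intro hs
    obtain ⟨h1, h2⟩ := h.arrival_support hk sel hs
    exact arrivalState_ne hk _ (h2.symm.trans (hc' h1))
  · intro s hsβ
    rw [(PMF.apply_eq_zero_iff _ _).mpr, ENNReal.toReal_zero]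
    intro hs
    obtain ⟨h1, h2⟩ := h.departure_support sel hsβ hs
    refine departureState_ne ?_ _ (h2.symm.trans (hc' h1))
    rw [reducedState_classConfig]
    exact jobs_pos_of_busy h.le_length hsβ

theorem queueGenerator_diag_ne_zero (hk : 1 ≤ k) (hlam : 0 < lam) (hmu : 0 < mu)
    (sel : Selection n k) {c : Config n} (hc : c ∈ admissibleConfigs n k t) :
    queueGenerator t lam mu sel c c ≠ 0 := by
  obtain ⟨b, p, β, h, rfl⟩ := hc
  obtain ⟨h1, h2⟩ := h.jump_eq_zero hk sel (c' := classConfig b p β) fun _ => rfl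
  rw [queueGenerator, busy_classConfig h.le_length, h1,
    Finset.sum_congr rfl fun s hs => by rw [h2 s hs]]
  simp only [PMF.pure_apply, if_true, ENNReal.toReal_one, Finset.sum_const, nsmul_eq_mul]
  nlinarith [mul_nonneg (Nat.cast_nonneg (α := ℝ) β.card) hmu.le]

theorem queueGenerator_closed (hk : 1 ≤ k) (sel : Selection n k) {c : Config n}
    (hc : c ∈ admissibleConfigs n k t) (c' : Config n) (hne : c' ≠ c)
    (hQ : queueGenerator t lam mu sel c c' ≠ 0) :
    c' ∈ admissibleConfigs n k t ∧ reducedState k t c' ≠ reducedState k t c := by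
  obtain ⟨b, p, β, h, rfl⟩ := hc
  by_contra hcon
  push Not at hcon
  obtain ⟨h1, h2⟩ := h.jump_eq_zero hk sel hcon
  refine hQ ?_
  rw [queueGenerator, busy_classConfig h.le_length, h1,
    Finset.sum_congr rfl fun s hs => by rw [h2 s hs]]
  simp [PMF.pure_apply, hne]

theorem queueGenerator_lump (hk : 1 ≤ k) (sel : Selection n k) {c : Config n}
    (hc : c ∈ admissibleConfigs n k t) (z : State k t) :
    HasSum ((reducedState k t ⁻¹' {z}).indicator (queueGenerator t lam mu sel c))
      (reducedGenerator n k t lam mu (reducedState k t c) z) := by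
  classical
  obtain ⟨b, p, β, h, rfl⟩ := hc
  set y := reducedState k t (classConfig b p β) with hy
  have hpure := hasSum_indicator_toReal (PMF.pure (classConfig b p β)) (reducedState k t) y
    (fun c hc => by rw [(PMF.mem_support_pure_iff _ _).mp hc]) z
  have harr := (hasSum_indicator_toReal _ (reducedState k t) (arrivalState n y)
    (fun c hc => (h.arrival_support hk sel hc).2) z).sub hpure
  have hdep : ∀ s ∈ β, HasSum _ _ := fun s hs =>
    ((hasSum_indicator_toReal _ (reducedState k t) (departureState n y (p s))
      (fun c hc => (h.departure_support sel hs hc).2) z).sub hpure).mul_left mu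
  refine hasSum_of_eq ((harr.mul_left lam).add (hasSum_sum hdep)) (fun c' => ?_) ?_
  · by_cases hc' : c' ∈ reducedState k t ⁻¹' {z}
    · simp only [Set.indicator_of_mem hc', queueGenerator, busy_classConfig h.le_length]
    · simp only [Set.indicator_of_notMem hc', sub_self, mul_zero, Finset.sum_const_zero, add_zero]
  · rw [reducedGenerator]
    refine congrArg₂ (· + ·) (by congr) ?_
    -- Busy servers of one class lead to the same reduced state, so their rates add up to `mu` times
    -- the class size.
    rw [← Finset.sum_fiberwise_of_maps_to (s := β) (t := Finset.range (t + 1)) (g := p)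
      fun s _ => Finset.mem_range.mpr (Nat.lt_succ_of_le (h.le_reserved s))]
    refine Finset.sum_congr rfl fun q _ => ?_
    rw [h.classCount_reducedState, Finset.sum_congr rfl fun s hs => by
      rw [(Finset.mem_filter.mp hs).2], Finset.sum_const, nsmul_eq_mul]
    ring_nf

theorem empty_eq_classConfig : Config.empty n = classConfig 0 (fun _ => 0) ∅ := rfl

theorem admissible_empty : Admissible k t 0 (fun _ : Fin n => 0) ∅ where
  le_length _ := le_rfl
  le_reserved _ := Nat.zero_le t
  idle_eq _ _ := (Nat.zero_min t).symm
  countAbove_lt j hj := absurd hj (Nat.not_lt_zero j)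
  idle_lt_of_zero _ hb := absurd hb (lt_irrefl 0)

theorem reducedState_empty : reducedState k t (Config.empty n) = (fun _ => 0, 0) := rfl

end Queue

end MDSQueue

theorem mainTheorem2 (n k t : ℕ) (hk : 1 ≤ k) (hkn : k ≤ n) :
    ∃ recover : MDSQueue.State k t → MDSQueue.Description,
      ∀ lam mu : ℝ, 0 < lam → 0 < mu →
        ∃ Q : Matrix (MDSQueue.State k t) (MDSQueue.State k t) ℝ,
          MDSQueue.IsQBD (MDSQueue.stateOf n k t) Q ∧
          ∀ (sel : MDSQueue.Selection n k) {Ω : Type*} [MeasurableSpace Ω]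
            (P : MeasureTheory.Measure Ω) [MeasureTheory.IsProbabilityMeasure P]
            (X : NNReal → Ω → MDSQueue.Config n),
            MDSQueue.IsReservationQueue P t lam mu sel X →
              MDSQueue.IsCTMC P Q (fun _ => 0, 0)
                (fun r ω => MDSQueue.reducedState k t (X r ω)) ∧
              ∀ᵐ ω ∂P, ∀ r : NNReal,
                MDSQueue.describe k (X r ω) = recover (MDSQueue.reducedState k t (X r ω)) := by
  refine ⟨MDSQueue.recover n, fun lam mu hlam hmu => ⟨MDSQueue.reducedGenerator n k t lam mu,
    MDSQueue.isQBD_reducedGenerator hk hkn hlam hmu, fun sel Ω _ P _ X hX => ?_⟩⟩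
  obtain ⟨h1, h2⟩ := MDSQueue.IsCTMC.lump (MDSQueue.isGenerator_queueGenerator hlam hmu sel)
    (MDSQueue.isGenerator_reducedGenerator hlam hmu) hX (MDSQueue.reducedState k t)
    (MDSQueue.admissibleConfigs n k t)
    ⟨_, _, _, MDSQueue.admissible_empty, MDSQueue.empty_eq_classConfig⟩
    (fun _ => MDSQueue.queueGenerator_diag_ne_zero hk hlam hmu sel)
    (fun _ => MDSQueue.queueGenerator_closed hk sel)
    (fun _ => MDSQueue.queueGenerator_lump hk sel)
  rw [MDSQueue.reducedState_empty] at h1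
  refine ⟨h1, ?_⟩
  filter_upwards [h2] with ω hω r
  obtain ⟨b, p, β, h, he⟩ := hω r
  rw [he]
  exact h.describe_eq hk
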